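/- Let $\{\xi_t\}_{t\in\mathbb Z}$ be a scalar process and $\{v_t\}_{t\in\mathbb Z}$ an $m$-dimensional process, and for $t\ge 1$ let $$x_t=\mu+x_{t-1}+v_t,\qquad y_t=d_t'\tau+x_t'\beta+u_t,\qquad u_t=\rho u_{t-1}+\xi_t,$$ with $\mu,\beta\in\mathbb R^m$ and initial values $x_0=O_{\mathbb P}(1)$, $u_0=O_{\mathbb P}(1)$. Consider the cases: D0 (no deterministic component: $d_t'\tau$ is absent, $\mu=0$, $x_0=0$); D1 ($d_t=1$, $\mu=0$); D2 ($d_t=[1,t]'$, $\mu$ unrestricted). Assume that $w_t=[\xi_t,v_t']'$ is strictly stationary and ergodic, with $\mathbb E(w_t)=0$, finite positive definite covariance matrix $\mathbb E(w_tw_t')$, and spectral density matrix $f_{ww}$ continuous on $(-\pi,\pi]$ such that $\Omega=\begin{bmatrix}\Omega_{\xi\xi}&\Omega_{\xi v}\\ \Omega_{v\xi}&\Omega_{vv}\end{bmatrix}:=2\pi f_{ww}(0)$ is positive definite, and that it satisfies the functional central limit theorem $$T^{-1/2}\sum_{t=1}^{\lfloor rT\rfloor}w_t\ \overset{w}{\longrightarrow}\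 \Omega^{1/2}W(r),\quad 0\le r\le 1,\qquad \Omega^{1/2}=\begin{bmatrix}\Omega_{\xi\cdot v}^{1/2}&\Omega_{\xi v}(\Omega_{vv}^{-1/2})'\\0&\Omega_{vv}^{1/2}\end{bmatrix},$$ in $D([0,1],\mathbb R^{1+m})$ with the Skorokhod topology, where $W=[W_{\xi\cdot v},W_v']'$ is a $(1+m)$-dimensional vector of independent standard Brownian motions, $\Omega_{\xi\cdot v}:=\Omega_{\xi\xi}-\Omega_{\xi v}\Omega_{vv}^{-1}\Omega_{v\xi}$, and $\Omega_{vv}^{1/2}$ is any matrix with $\Omega_{vv}^{1/2}(\Omega_{vv}^{1/2})'=\Omega_{vv}$ (and $\Omega_{vv}^{-1/2}$ its inverse). For a sample of size $T$ let $\widetilde y_t,\widetilde x_t$ be the OLS detrended series, $[\widetilde y_t,\widetilde x_t']=[y_t,x_t']-d_t'\bigl(\sum_{s=1}^Td_sd_s'\bigr)^{-1}\sum_{s=1}^Td_s[y_s,x_s']$ in cases D1 and D2, and $[\widetilde y_t,\widetilde x_t']=[y_t,x_t']$ in case D0. Let $\widehat u_t=\widetilde y_t-\widetilde x_t'\bigl(\sum_{s=1}^T\widetilde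 x_s\widetilde x_s'\bigr)^{-1}\sum_{s=1}^T\widetilde x_s\widetilde y_s$ be the OLS residuals, and $$\mathrm{VR}=\frac{T^{-2}\sum_{t=1}^T\bigl(\sum_{s=1}^t\widehat u_s\bigr)^2}{\sum_{t=1}^T\widehat u_t^2}.$$ For a process $P$ on $[0,1]$ let $\widetilde P(r)=P(r)$ in case D0, $\widetilde P(r)=P(r)-\int_0^1P(s)\,ds$ in case D1, and $\widetilde P(r)=P(r)-(4-6r)\int_0^1P(s)\,ds-(12r-6)\int_0^1sP(s)\,ds$ in case D2. Then under the null hypothesis of no cointegration ($\rho=1$), in each of the cases D0, D1 and D2, as $T\to\infty$, $$\mathrm{VR}\ \overset{w}{\longrightarrow}\ \frac{\int_0^1\bigl(\int_0^r\widetilde W^+_{\xi\cdot v}(s)\,ds\bigr)^2dr}{\int_0^1\bigl(\widetilde W^+_{\xi\cdot v}(r)\bigr)^2dr},$$ where $$\widetilde W^+_{\xi\cdot v}(r)=\widetilde W_{\xi\cdot v}(r)-\widetilde W_v(r)'\Bigl(\int_0^1\widetilde W_v(s)\widetilde W_v(s)'ds\Bigr)^{-1}\int_0^1\widetilde W_v(s)\widetilde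 W_{\xi\cdot v}(s)\,ds.$$ In particular the limit depends only on $m$ and on the case, and not on $\Omega$ or any other nuisance parameter. -/

import Mathlib

open MeasureTheory ProbabilityTheory Filter Topology Matrix
open scoped NNReal unitInterval

noncomputable section

namespace VarianceRatio

/-! ### The Skorokhod space `D([0,1], E)` -/

/-- Right-continuous functions on `[0,1]` with left limits. -/
def IsCadlag {E : Type*} [TopologicalSpace E] (f : I → E) : Prop :=
  ∀ r : I, ContinuousWithinAt f (Set.Ici r) r ∧ ∃ l : E, Tendsto f (𝓝[<] r) (𝓝 l)

/-- The space `D([0,1], E)` of càdlàg functions. -/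
def Skorokhod (E : Type*) [TopologicalSpace E] : Type _ := {f : I → E // IsCadlag f}

/-- `g` is within Skorokhod distance `ε` of `f`: there is an increasing bijection `φ` of `[0,1]`
(a time change) with `|φ r - r| < ε` and `‖g r - f (φ r)‖ < ε` for all `r`. -/
def Skorokhod.Near {E : Type*} [NormedAddCommGroup E] (ε : ℝ) (f g : Skorokhod E) : Prop :=
  ∃ φ : I ≃o I, (∀ r : I, |(φ r : ℝ) - (r : ℝ)| < ε) ∧ ∀ r : I, ‖g.1 r - f.1 (φ r)‖ < ε

/-- The Skorokhod (J1) topology: a set is open when it contains, with each of its points, a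
Skorokhod ball around it. -/
instance Skorokhod.instTopologicalSpace {E : Type*} [NormedAddCommGroup E] :
    TopologicalSpace (Skorokhod E) where
  IsOpen U := ∀ f ∈ U, ∃ ε : ℝ, 0 < ε ∧ ∀ g, Skorokhod.Near ε f g → g ∈ U
  isOpen_univ := fun _ _ => ⟨1, one_pos, fun _ _ => trivial⟩
  isOpen_inter := by
    intro U V hU hV f hf
    obtain ⟨a, ha, hUa⟩ := hU f hf.1
    obtain ⟨b, hb, hVb⟩ := hV f hf.2
    refine ⟨min a b, lt_min ha hb, fun g hg => ?_⟩
    obtain ⟨φ, h1, h2⟩ := hg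
    exact ⟨hUa g ⟨φ, fun r => (h1 r).trans_le (min_le_left _ _),
        fun r => (h2 r).trans_le (min_le_left _ _)⟩,
      hVb g ⟨φ, fun r => (h1 r).trans_le (min_le_right _ _),
        fun r => (h2 r).trans_le (min_le_right _ _)⟩⟩
  isOpen_sUnion := by
    rintro S hS f ⟨U, hU, hf⟩
    obtain ⟨a, ha, h⟩ := hS U hU f hf
    exact ⟨a, ha, fun g hg => ⟨U, hU, h g hg⟩⟩

/-- The Borel σ-algebra of the Skorokhod topology. -/
instance Skorokhod.instMeasurableSpace {E : Type*} [NormedAddCommGroup E] :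
    MeasurableSpace (Skorokhod E) := borel _

instance Skorokhod.instBorelSpace {E : Type*} [NormedAddCommGroup E] :
    BorelSpace (Skorokhod E) := ⟨rfl⟩

theorem isCadlag_zero {E : Type*} [NormedAddCommGroup E] : IsCadlag (fun _ : I => (0 : E)) :=
  fun _ => ⟨continuousWithinAt_const, 0, tendsto_const_nhds⟩

open Classical in
/-- A càdlàg path as a point of `D([0,1], E)`. The default value `0` is only met on the null set
where a path of an almost surely continuous process fails to be càdlàg. -/
def Skorokhod.ofPath {E : Type*} [NormedAddCommGroup E] (f : I → E) : Skorokhod E :=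
  if h : IsCadlag f then ⟨f, h⟩ else ⟨fun _ => 0, isCadlag_zero⟩

/-! ### Partial sum processes -/

/-- `T^{-1/2} ∑_{t=1}^{⌊rT⌋} a_t`, `0 ≤ r ≤ 1`. -/
def partialSumPath {E : Type*} [NormedAddCommGroup E] [NormedSpace ℝ E]
    (a : ℤ → E) (T : ℕ) (r : I) : E :=
  (√(T : ℝ))⁻¹ • ∑ t ∈ Finset.Icc (1 : ℤ) ⌊(r : ℝ) * T⌋, a t

theorem isCadlag_partialSumPath {E : Type*} [NormedAddCommGroup E] [NormedSpace ℝ E]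
    (a : ℤ → E) (T : ℕ) : IsCadlag (partialSumPath a T) := by
  intro r
  rcases Nat.eq_zero_or_pos T with hT | hT
  · subst hT
    have h0 : partialSumPath a 0 = fun _ => (0 : E) := by
      funext s; simp [partialSumPath]
    rw [h0]
    exact isCadlag_zero r
  have hT' : (0 : ℝ) < T := by exact_mod_cast hT
  have hc : Continuous (fun s : I => (s : ℝ) * T) := by fun_prop
  constructor
  · have h1 : ∀ᶠ s : I in 𝓝[≥] r, ⌊(s : ℝ) * T⌋ = ⌊(r : ℝ) * T⌋ := by
      have h2 : ∀ᶠ s : I in 𝓝[≥] r, (s : ℝ) * T < ⌊(r : ℝ) * T⌋ + 1 :=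
        nhdsWithin_le_nhds ((hc.tendsto r).eventually_lt_const (Int.lt_floor_add_one _))
      filter_upwards [h2, self_mem_nhdsWithin] with s hs hs'
      rw [Int.floor_eq_iff]
      refine ⟨(Int.floor_le _).trans ?_, hs⟩
      exact mul_le_mul_of_nonneg_right hs' hT'.le
    refine Tendsto.congr' (f₁ := fun _ => partialSumPath a T r) ?_ tendsto_const_nhds
    filter_upwards [h1] with s hs
    simp only [partialSumPath, hs]
  · refine ⟨(√(T : ℝ))⁻¹ • ∑ t ∈ Finset.Icc (1 : ℤ) (⌈(r : ℝ) * T⌉ - 1), a t, ?_⟩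
    have h1 : ∀ᶠ s : I in 𝓝[<] r, ⌊(s : ℝ) * T⌋ = ⌈(r : ℝ) * T⌉ - 1 := by
      have h2 : ∀ᶠ s : I in 𝓝[<] r, ((⌈(r : ℝ) * T⌉ : ℝ) - 1) < (s : ℝ) * T := by
        refine nhdsWithin_le_nhds ((hc.tendsto r).eventually_const_lt ?_)
        linarith [Int.ceil_lt_add_one ((r : ℝ) * T)]
      filter_upwards [h2, self_mem_nhdsWithin] with s hs hs'
      rw [Int.floor_eq_iff]
      push_cast
      refine ⟨hs.le, ?_⟩
      have h3 : (s : ℝ) * T < (r : ℝ) * T := mul_lt_mul_of_pos_right hs' hT'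
      linarith [Int.le_ceil ((r : ℝ) * T)]
    refine Tendsto.congr' ?_ tendsto_const_nhds
    filter_upwards [h1] with s hs
    simp only [partialSumPath, hs]

/-- The partial sum process as a random element of `D([0,1], E)`. -/
def partialSumProcess {E : Type*} [NormedAddCommGroup E] [NormedSpace ℝ E]
    {S : Type*} (w : ℤ → S → E) (T : ℕ) (ω : S) : Skorokhod E :=
  ⟨partialSumPath (fun t => w t ω) T, isCadlag_partialSumPath _ T⟩

/-! ### The error-regressor process -/

/-- The index set of `w_t = [ξ_t, v_t']'`, of size `1 + m`. -/
abbrev Idx (m : ℕ) : Type := Unit ⊕ Fin m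

/-- `w_t = [ξ_t, v_t']'`. -/
def stack {S : Type*} {m : ℕ} (ξ : ℤ → S → ℝ) (v : ℤ → S → Fin m → ℝ) (t : ℤ) (ω : S) :
    Idx m → ℝ :=
  Sum.elim (fun _ => ξ t ω) (v t ω)

/-- The autocovariance matrix `E(w_h w_0')` of a centred stationary process at lag `h`. -/
def autocov {S ι : Type*} [MeasurableSpace S] (P : Measure S) (w : ℤ → S → ι → ℝ) (h : ℤ) :
    Matrix ι ι ℝ :=
  Matrix.of fun i j => ∫ ω, w h ω i * w 0 ω j ∂P

/-- Strict stationarity and ergodicity: the shift on the path space `E^ℤ` preserves the law of the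
process and is ergodic for it. -/
def IsStationaryErgodic {S E : Type*} [MeasurableSpace S] [MeasurableSpace E]
    (P : Measure S) (w : ℤ → S → E) : Prop :=
  Ergodic (fun (p : ℤ → E) (t : ℤ) => p (t + 1)) (P.map fun ω t => w t ω)

/-- `f` is a spectral density matrix of the centred stationary process `w`:
`E(w_h w_0') = ∫_{-π}^{π} e^{ihλ} f(λ) dλ` for all lags `h`. -/
structure IsSpectralDensity {S ι : Type*} [MeasurableSpace S]
    (P : Measure S) (w : ℤ → S → ι → ℝ) (f : ℝ → Matrix ι ι ℂ) : Prop where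
  integrable : ∀ i j, IntegrableOn (fun l => f l i j) (Set.Ioc (-Real.pi) Real.pi)
  autocov_eq : ∀ (h : ℤ) (i j : ι), (autocov P w h i j : ℂ) =
    ∫ l in Set.Ioc (-Real.pi) Real.pi, Complex.exp (Complex.I * h * l) * f l i j

/-- The long-run covariance matrix `2π f(0)`; for a real process `f(0)` is real. -/
def longRunCov {ι : Type*} (f : ℝ → Matrix ι ι ℂ) : Matrix ι ι ℝ :=
  Matrix.of fun i j => 2 * Real.pi * (f 0 i j).re

/-- `Ω_{ξ·v} = Ω_ξξ - Ω_ξv Ω_vv⁻¹ Ω_vξ`. -/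
def condVariance {m : ℕ} (Om : Matrix (Idx m) (Idx m) ℝ) : ℝ :=
  (Om.toBlocks₁₁ - Om.toBlocks₁₂ * Om.toBlocks₂₂⁻¹ * Om.toBlocks₂₁) () ()

/-- The block triangular square root `[[Ω_{ξ·v}^{1/2}, Ω_ξv (C⁻¹)'], [0, C]]` of `Ω`, where `C`
is a square root `Ω_vv^{1/2}` of `Ω_vv`. -/
def triangularRoot {m : ℕ} (Om : Matrix (Idx m) (Idx m) ℝ) (C : Matrix (Fin m) (Fin m) ℝ) :
    Matrix (Idx m) (Idx m) ℝ :=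
  Matrix.fromBlocks (Matrix.of fun _ _ => √(condVariance Om)) (Om.toBlocks₁₂ * (C⁻¹)ᵀ) 0 C

/-- A vector of independent standard Brownian motions. -/
structure IsStdBrownian {S ι : Type*} [MeasurableSpace S]
    (P : Measure S) (W : ι → ℝ≥0 → S → ℝ) : Prop where
  brownian : ∀ i, IsBrownianReal (W i) P
  indep : iIndepFun (fun i ω (t : ℝ≥0) => W i t ω) P

/-- The path on `[0,1]` of `B(r) = A W(r)`. -/
def linearPath {S ι : Type*} [Fintype ι] (A : Matrix ι ι ℝ) (W : ι → ℝ≥0 → S → ℝ)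
    (ω : S) (r : I) : ι → ℝ :=
  A *ᵥ fun i => W i (Real.toNNReal r) ω

/-- The standing assumption on `w_t = [ξ_t, v_t']'`: a strictly stationary, ergodic, centred process
with positive definite covariance matrix, continuous spectral density `f` with positive definite
`Ω = 2π f(0)`, whose partial sums satisfy the functional central limit theorem with limit
`Ω^{1/2} W` in `D([0,1], ℝ^{1+m})`, where `Ω^{1/2}` is built from the square root `C` of `Ω_vv`. -/
structure ErrorAssumption {S S' : Type*} [MeasurableSpace S] [MeasurableSpace S']
    (P : Measure S) [IsProbabilityMeasure P] (P' : Measure S') [IsProbabilityMeasure P'] {m : ℕ}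
    (ξ : ℤ → S → ℝ) (v : ℤ → S → Fin m → ℝ) (f : ℝ → Matrix (Idx m) (Idx m) ℂ)
    (C : Matrix (Fin m) (Fin m) ℝ) (W : Idx m → ℝ≥0 → S' → ℝ) : Prop where
  measurable : ∀ t, Measurable (stack ξ v t)
  stationary_ergodic : IsStationaryErgodic P (stack ξ v)
  square_integrable : ∀ t i, MemLp (fun ω => stack ξ v t ω i) 2 P
  centred : ∀ t i, ∫ ω, stack ξ v t ω i ∂P = 0
  cov_posDef : (autocov P (stack ξ v) 0).PosDef
  spectral : IsSpectralDensity P (stack ξ v) f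
  spectral_continuous : ContinuousOn f (Set.Ioc (-Real.pi) Real.pi)
  longRun_posDef : (longRunCov f).PosDef
  root : C * Cᵀ = (longRunCov f).toBlocks₂₂
  brownian : IsStdBrownian P' W
  fclt : TendstoInDistribution (partialSumProcess (stack ξ v)) atTop
    (fun ω => Skorokhod.ofPath (linearPath (triangularRoot (longRunCov f) C) W ω))
    (fun _ => P) P'

/-! ### The model -/

/-- The specifications of the deterministic component: `D0` none, `D1` intercept, `D2` intercept
and linear trend. -/
inductive DetCase : Type
  | D0
  | D1
  | D2

/-- The dimension `p` of `d_t`. -/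
abbrev DetCase.dim : DetCase → ℕ
  | .D0 => 0
  | .D1 => 1
  | .D2 => 2

/-- The deterministic component: empty in `D0`, `d_t = 1` in `D1`, `d_t = [1, t]'` in `D2`. -/
def DetCase.det : (c : DetCase) → ℕ → Fin c.dim → ℝ
  | .D0, _ => ![]
  | .D1, _ => ![1]
  | .D2, t => ![1, (t : ℝ)]

/-- `X_T = O_P(1)`. -/
def IsBoundedInProb {S E : Type*} [MeasurableSpace S] [NormedAddCommGroup E]
    (P : Measure S) (X : ℕ → S → E) : Prop :=
  ∀ ε : ℝ, 0 < ε → ∃ M : ℝ, ∀ᶠ T in atTop, P.real {ω | M < ‖X T ω‖} ≤ ε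

/-- The data generating process
`x_t = μ + x_{t-1} + v_t`, `y_t = d_t'τ + x_t'β + u_t`, `u_t = ρ u_{t-1} + ξ_t`, `t ≥ 1`.
The first index of `x`, `y`, `u` is the sample size `T`, the second is time: the initial values
`x_0 = O_P(1)` and `u_0 = O_P(1)` may depend on the sample size (families constant in `T` are
the special case of a single process). -/
structure IsModel {S : Type*} [MeasurableSpace S] (P : Measure S) {m : ℕ} (c : DetCase) (ρ : ℝ)
    (μ β : Fin m → ℝ) (τ : Fin c.dim → ℝ) (ξ : ℤ → S → ℝ) (v : ℤ → S → Fin m → ℝ)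
    (x : ℕ → ℕ → S → Fin m → ℝ) (y u : ℕ → ℕ → S → ℝ) : Prop where
  x_eq : ∀ T t ω, x T (t + 1) ω = μ + x T t ω + v ((t : ℤ) + 1) ω
  y_eq : ∀ T t ω, y T (t + 1) ω = c.det (t + 1) ⬝ᵥ τ + x T (t + 1) ω ⬝ᵥ β + u T (t + 1) ω
  u_eq : ∀ T t ω, u T (t + 1) ω = ρ * u T t ω + ξ ((t : ℤ) + 1) ω
  measurable_x₀ : ∀ T, Measurable (x T 0)
  measurable_u₀ : ∀ T, Measurable (u T 0)
  x₀_bounded : IsBoundedInProb P fun T => x T 0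
  u₀_bounded : IsBoundedInProb P fun T => u T 0
  drift_zero : c = .D0 ∨ c = .D1 → μ = 0
  x₀_zero : c = .D0 → ∀ T ω, x T 0 ω = 0

/-! ### Ordinary least squares and the variance ratio statistic -/

/-- The OLS coefficient `(∑_{t=1}^T a_t a_t')⁻¹ ∑_{t=1}^T a_t z_t`. -/
def olsCoef {ι : Type*} [Fintype ι] [DecidableEq ι] (T : ℕ) (a : ℕ → ι → ℝ) (z : ℕ → ℝ) :
    ι → ℝ :=
  (∑ t ∈ Finset.Icc 1 T, Matrix.vecMulVec (a t) (a t))⁻¹ *ᵥ ∑ t ∈ Finset.Icc 1 T, z t • a t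

/-- The OLS residual at time `t` in the regression of `z` on `a` over `1, …, T`. -/
def olsResid {ι : Type*} [Fintype ι] [DecidableEq ι] (T : ℕ) (a : ℕ → ι → ℝ) (z : ℕ → ℝ)
    (t : ℕ) : ℝ :=
  z t - a t ⬝ᵥ olsCoef T a z

/-- The OLS detrended series; in case `D0` the vector `d_t` is empty and this is `z` itself. -/
def detrend (c : DetCase) (T : ℕ) (z : ℕ → ℝ) : ℕ → ℝ := olsResid T c.det z

/-- The residuals of the OLS regression of the detrended `y` on the detrended `x`. -/
def residual (c : DetCase) {m : ℕ} (T : ℕ) (x : ℕ → Fin m → ℝ) (y : ℕ → ℝ) : ℕ → ℝ :=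
  olsResid T (fun t i => detrend c T (fun s => x s i) t) (detrend c T y)

/-- The variance ratio statistic of a series `e_1, …, e_T`. -/
def varianceRatio (T : ℕ) (e : ℕ → ℝ) : ℝ :=
  (((T : ℝ) ^ 2)⁻¹ * ∑ t ∈ Finset.Icc 1 T, (∑ s ∈ Finset.Icc 1 t, e s) ^ 2) /
    ∑ t ∈ Finset.Icc 1 T, e t ^ 2

/-! ### The limit -/

/-- The detrended version of a path on `[0,1]`. -/
def detrendPath (c : DetCase) (p : ℝ → ℝ) (r : ℝ) : ℝ :=
  match c with
  | .D0 => p r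
  | .D1 => p r - ∫ s in (0 : ℝ)..1, p s
  | .D2 => p r - (4 - 6 * r) * (∫ s in (0 : ℝ)..1, p s)
      - (12 * r - 6) * ∫ s in (0 : ℝ)..1, s * p s

/-- `p(r) - q(r)' (∫₀¹ q q')⁻¹ ∫₀¹ q p`: the path `p` minus its projection on the path `q`. -/
def projectOut {ι : Type*} [Fintype ι] [DecidableEq ι] (q : ℝ → ι → ℝ) (p : ℝ → ℝ) (r : ℝ) : ℝ :=
  p r - q r ⬝ᵥ ((Matrix.of fun i j => ∫ s in (0 : ℝ)..1, q s i * q s j)⁻¹ *ᵥ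
    fun i => ∫ s in (0 : ℝ)..1, q s i * p s)

/-- The process `W̃⁺_{ξ·v}`, where `W = [W_{ξ·v}, W_v']'`. -/
def wPlus (c : DetCase) {m : ℕ} {S : Type*} (W : Idx m → ℝ≥0 → S → ℝ) (ω : S) : ℝ → ℝ :=
  projectOut
    (fun r i => detrendPath c (fun s => W (Sum.inr i) s.toNNReal ω) r)
    (detrendPath c fun s => W (Sum.inl ()) s.toNNReal ω)

/-- The limiting random variable
`∫₀¹ (∫₀^r W̃⁺_{ξ·v}(s) ds)² dr / ∫₀¹ W̃⁺_{ξ·v}(r)² dr`. -/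
def limitVR (c : DetCase) {m : ℕ} {S : Type*} (W : Idx m → ℝ≥0 → S → ℝ) (ω : S) : ℝ :=
  (∫ r in (0 : ℝ)..1, (∫ s in (0 : ℝ)..r, wPlus c W ω s) ^ 2) /
    ∫ r in (0 : ℝ)..1, wPlus c W ω r ^ 2

end VarianceRatio

end

open VarianceRatio

namespace VarianceRatio

open scoped ENNReal

/-! ### The Skorokhod topology is pseudometrizable -/

/-! Under `ρ = 1` the regressors and the errors are, up to initial values and drift, the partial
sums of `w_t`, so the statistic is a function of the partial sum path at the grid points `t / T`,
perturbed by initial values that vanish after division by `√T`. It is therefore enough to prove a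
deterministic convergence along paths and lift it by an extended continuous mapping theorem,
`tendstoInDistribution_of_relation`. The statistic depends on `T`, the initial values and the path,
so it is tied to the path by a relation, `IsModelStatistic`, instead of being written as a fixed
functional.

Nuisance parameters disappear before any limit is taken. Least squares residuals are unchanged by an
invertible change of regressors and by adding combinations of the regressors to the dependent
variable, and the variance ratio is unchanged by scaling (`residual_eq`, `varianceRatio_const_mul`).
With the triangular root of `Ω`, the data can be replaced by series `X` and `Z` that converge to
`W_v` and `W_{ξ·v}` themselves (`tendsto_isModelStatistic`).

Skorokhod convergence to a continuous path is uniform, sample moments are then Riemann sums, and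
detrending, regression and the ratio pass to the limit wherever the limiting Gram determinant and
denominator are nonzero (`GridConv.olsResid`, `GridConv.varianceRatio`).

Nondegeneracy holds almost surely: detrending subtracts an affine function, and no nontrivial
combination of independent Brownian paths is affine on `[0,1]`. This follows because the matrix of
their second differences on a finite grid is almost surely invertible
(`IsStdBrownian.ae_not_affine`). -/

theorem Skorokhod.Near.symm {E : Type*} [NormedAddCommGroup E] {ε : ℝ} {f g : Skorokhod E}
    (h : Skorokhod.Near ε f g) : Skorokhod.Near ε g f := by
  obtain ⟨φ, h1, h2⟩ := h
  refine ⟨φ.symm, fun r => ?_, fun r => ?_⟩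
  · have := h1 (φ.symm r)
    rwa [OrderIso.apply_symm_apply, abs_sub_comm] at this
  · have := h2 (φ.symm r)
    rwa [OrderIso.apply_symm_apply, norm_sub_rev] at this

theorem Skorokhod.Near.trans {E : Type*} [NormedAddCommGroup E] {a b : ℝ} {f g h : Skorokhod E}
    (hfg : Skorokhod.Near a f g) (hgh : Skorokhod.Near b g h) : Skorokhod.Near (a + b) f h := by
  obtain ⟨φ, h1, h2⟩ := hfg
  obtain ⟨ψ, h3, h4⟩ := hgh
  refine ⟨ψ.trans φ, fun r => ?_, fun r => ?_⟩
  · calc |(φ (ψ r) : ℝ) - r| ≤ |(φ (ψ r) : ℝ) - ψ r| + |(ψ r : ℝ) - r| := abs_sub_le _ _ _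
      _ < a + b := add_lt_add (h1 _) (h3 _)
  · calc ‖h.1 r - f.1 (φ (ψ r))‖ ≤ ‖h.1 r - g.1 (ψ r)‖ + ‖g.1 (ψ r) - f.1 (φ (ψ r))‖ :=
        norm_sub_le_norm_sub_add_norm_sub _ _ _
      _ < a + b := by rw [add_comm]; exact add_lt_add (h2 _) (h4 _)

theorem Skorokhod.Near.mono {E : Type*} [NormedAddCommGroup E] {a b : ℝ} {f g : Skorokhod E}
    (h : Skorokhod.Near a f g) (hab : a ≤ b) : Skorokhod.Near b f g := by
  obtain ⟨φ, h1, h2⟩ := h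
  exact ⟨φ, fun r => (h1 r).trans_le hab, fun r => (h2 r).trans_le hab⟩

theorem Skorokhod.near_refl {E : Type*} [NormedAddCommGroup E] {ε : ℝ} (hε : 0 < ε)
    (f : Skorokhod E) : Skorokhod.Near ε f f :=
  ⟨OrderIso.refl _, fun r => by simpa using hε, fun r => by simpa using hε⟩

/-- The Skorokhod distance. -/
noncomputable def skorokhodEDist {E : Type*} [NormedAddCommGroup E] (f g : Skorokhod E) : ℝ≥0∞ :=
  ⨅ (ε : ℝ≥0) (_ : Skorokhod.Near ε f g), (ε : ℝ≥0∞)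

theorem skorokhodEDist_lt_iff {E : Type*} [NormedAddCommGroup E] {f g : Skorokhod E} {a : ℝ≥0∞} :
    skorokhodEDist f g < a ↔ ∃ ε : ℝ≥0, Skorokhod.Near ε f g ∧ (ε : ℝ≥0∞) < a := by
  simp only [skorokhodEDist, iInf_lt_iff, exists_prop]

theorem skorokhodEDist_comm {E : Type*} [NormedAddCommGroup E] (f g : Skorokhod E) :
    skorokhodEDist f g = skorokhodEDist g f := by
  simp only [skorokhodEDist]
  exact iInf_congr fun ε => iInf_congr_Prop ⟨fun h => h.symm, fun h => h.symm⟩ fun _ => rfl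

/-- The pseudometric structure of the Skorokhod space. -/
noncomputable abbrev skorokhodPseudoEMetric (E : Type*) [NormedAddCommGroup E] :
    PseudoEMetricSpace (Skorokhod E) where
  edist := skorokhodEDist
  edist_self f := by
    refine le_antisymm (ENNReal.le_of_forall_pos_le_add fun ε hε _ => ?_) zero_le
    rw [zero_add]
    exact iInf₂_le ε (Skorokhod.near_refl (by exact_mod_cast hε) f)
  edist_comm := skorokhodEDist_comm
  edist_triangle f g h := by
    refine le_of_forall_gt fun c hc => ?_
    obtain ⟨a, b, hab⟩ : ∃ a b : ℝ≥0∞, skorokhodEDist f g < a ∧ skorokhodEDist g h < b ∧ a + b ≤ c := by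
      obtain ⟨δ, hδ, hδc⟩ := ENNReal.lt_iff_exists_add_pos_lt.1 hc
      have h1 : skorokhodEDist f g ≠ ∞ := fun h' => by simp [h'] at hc
      have h2 : skorokhodEDist g h ≠ ∞ := fun h' => by simp [h'] at hc
      have hδ' : ((δ / 2 : ℝ≥0) : ℝ≥0∞) ≠ 0 := by
        simpa using hδ.ne'
      refine ⟨skorokhodEDist f g + (δ / 2 : ℝ≥0), skorokhodEDist g h + (δ / 2 : ℝ≥0),
        ENNReal.lt_add_right h1 hδ', ENNReal.lt_add_right h2 hδ', le_of_eq_of_le ?_ hδc.le⟩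
      rw [add_add_add_comm, ← ENNReal.coe_add, add_halves]
    obtain ⟨ε₁, n1, l1⟩ := skorokhodEDist_lt_iff.1 hab.1
    obtain ⟨ε₂, n2, l2⟩ := skorokhodEDist_lt_iff.1 hab.2.1
    refine skorokhodEDist_lt_iff.2 ⟨ε₁ + ε₂, by simpa using n1.trans n2, ?_⟩
    push_cast
    exact (ENNReal.add_lt_add l1 l2).trans_le hab.2.2

theorem Skorokhod.isOpen_iff {E : Type*} [NormedAddCommGroup E] {U : Set (Skorokhod E)} :
    IsOpen U ↔ ∀ f ∈ U, ∃ ε : ℝ, 0 < ε ∧ ∀ g, Skorokhod.Near ε f g → g ∈ U := Iff.rfl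

theorem skorokhodPseudoEMetric_topology (E : Type*) [NormedAddCommGroup E] :
    (skorokhodPseudoEMetric E).toUniformSpace.toTopologicalSpace =
      Skorokhod.instTopologicalSpace := by
  ext U
  rw [Skorokhod.isOpen_iff, @EMetric.isOpen_iff _ (skorokhodPseudoEMetric E)]
  refine forall₂_congr fun f hf => ⟨?_, ?_⟩
  · rintro ⟨ε, hε, h⟩
    obtain ⟨δ, hδ0, hδ⟩ := ENNReal.lt_iff_exists_nnreal_btwn.1 hε
    refine ⟨δ, by simpa using hδ0, fun g hg => h ?_⟩
    change skorokhodEDist g f < ε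
    rw [skorokhodEDist_comm]
    exact skorokhodEDist_lt_iff.2 ⟨δ, hg, hδ⟩
  · rintro ⟨ε, hε, h⟩
    refine ⟨ENNReal.ofReal ε, by simpa using hε, fun g hg => h g ?_⟩
    change skorokhodEDist g f < _ at hg
    rw [skorokhodEDist_comm] at hg
    obtain ⟨δ, hn, hδ⟩ := skorokhodEDist_lt_iff.1 hg
    exact hn.mono ((NNReal.coe_le_coe.2 (ENNReal.coe_lt_coe.1 hδ).le).trans
      (Real.coe_toNNReal ε hε.le).le)

/-- Needed twice in the continuous mapping argument: for the portmanteau inequality on closed sets,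
and to approach a point of a closure along a sequence. -/
instance Skorokhod.instPseudoMetrizableSpace (E : Type*) [NormedAddCommGroup E] :
    TopologicalSpace.PseudoMetrizableSpace (Skorokhod E) := by
  have h := skorokhodPseudoEMetric_topology E
  let := skorokhodPseudoEMetric E
  have h2 : @TopologicalSpace.PseudoMetrizableSpace (Skorokhod E)
      (skorokhodPseudoEMetric E).toUniformSpace.toTopologicalSpace :=
    @UniformSpace.pseudoMetrizableSpace _ (skorokhodPseudoEMetric E).toUniformSpace inferInstance
  rwa [h] at h2

/-- The set of paths that are near with some slack to spare contains `f` and is open by the triangle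
inequality, so openness of the `Near` ball itself is not required. -/
theorem Skorokhod.eventually_near {E : Type*} [NormedAddCommGroup E] (f : Skorokhod E) {ε : ℝ}
    (hε : 0 < ε) : ∀ᶠ g in 𝓝 f, Skorokhod.Near ε f g := by
  have h : f ∈ {g : Skorokhod E | ∃ δ : ℝ, 0 < δ ∧ Skorokhod.Near (ε - δ) f g} :=
    ⟨ε / 2, by positivity, Skorokhod.near_refl (by linarith) f⟩
  refine mem_of_superset (IsOpen.mem_nhds (Skorokhod.isOpen_iff.2 ?_) h) ?_
  · rintro g ⟨δ, hδ, hg⟩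
    exact ⟨δ / 2, by positivity, fun k hk => ⟨δ / 2, by positivity,
      (hg.trans hk).mono (by linarith)⟩⟩
  · rintro g ⟨δ, hδ, hg⟩
    exact hg.mono (by linarith)

/-- Skorokhod convergence to a continuous path is uniform. -/
theorem Skorokhod.tendstoUniformly_of_tendsto {E : Type*} [NormedAddCommGroup E]
    {f : Skorokhod E} (hf : Continuous f.1) {g : ℕ → Skorokhod E}
    (hg : Tendsto g atTop (𝓝 f)) : TendstoUniformly (fun k => (g k).1) f.1 atTop := by
  rw [Metric.tendstoUniformly_iff]
  intro ε hε
  -- Uniform continuity of the limit path absorbs the time change.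
  obtain ⟨δ, hδ, h⟩ := Metric.uniformContinuous_iff.1
    (CompactSpace.uniformContinuous_of_continuous hf) (ε / 2) (by positivity)
  filter_upwards [hg.eventually (f.eventually_near (lt_min hδ (half_pos hε)))] with k hk r
  obtain ⟨φ, h1, h2⟩ := hk
  have h3 : dist (f.1 (φ r)) (f.1 r) < ε / 2 := h (by
    rw [Subtype.dist_eq, Real.dist_eq]
    exact (h1 r).trans_le (min_le_left _ _))
  have h4 : dist ((g k).1 r) (f.1 (φ r)) < ε / 2 := by
    rw [dist_eq_norm]
    exact (h2 r).trans_le (min_le_right _ _)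
  rw [dist_comm]
  linarith [dist_triangle ((g k).1 r) (f.1 (φ r)) (f.1 r)]

/-! ### The extended continuous mapping theorem -/

/-- **Extended continuous mapping theorem**: if `X n` converges in distribution to `X'`, and, with
probability close to one, `Z n` is related to `X n` by a relation `R n` which forces convergence to
`Z'` along every sequence converging to a value of `X'`, then `Z n` converges in distribution to
`Z'`. -/
theorem tendstoInDistribution_of_relation {S S' E : Type*} [MeasurableSpace S] [MeasurableSpace S']
    {P : Measure S} [IsProbabilityMeasure P] {P' : Measure S'} [IsProbabilityMeasure P']
    [TopologicalSpace E] [TopologicalSpace.PseudoMetrizableSpace E] [MeasurableSpace E]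
    [BorelSpace E] {X : ℕ → S → E} {X' : S' → E}
    (hX : TendstoInDistribution X atTop X' (fun _ => P) P') {Z : ℕ → S → ℝ} {Z' : S' → ℝ}
    (hZ : ∀ n, AEMeasurable (Z n) P) (hZ' : AEMeasurable Z' P')
    (h : ∀ η : ℝ≥0, 0 < η → ∃ R : ℕ → E → ℝ → Prop,
      (∀ᶠ n in atTop, P {ω | ¬ R n (X n ω) (Z n ω)} ≤ η) ∧
      ∀ᵐ ω ∂P', ∀ (φ : ℕ → ℕ) (g : ℕ → E) (z : ℕ → ℝ), Tendsto φ atTop atTop →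
        Tendsto g atTop (𝓝 (X' ω)) → (∀ k, R (φ k) (g k) (z k)) →
        Tendsto z atTop (𝓝 (Z' ω))) :
    TendstoInDistribution Z atTop Z' (fun _ => P) P' := by
  refine ⟨hZ, hZ', tendsto_of_forall_isClosed_limsup_le' fun K hK => ?_⟩
  simp only [ProbabilityMeasure.coe_mk]
  rw [Measure.map_apply_of_aemeasurable hZ' hK.measurableSet]
  simp_rw [fun n => Measure.map_apply_of_aemeasurable (hZ n) hK.measurableSet]
  refine ENNReal.le_of_forall_pos_le_add fun η hη _ => ?_
  obtain ⟨R, hR, hlim⟩ := h η hη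
  -- `B k` collects, up to closure, the paths that can be related at some index `≥ k` to a value in
  -- `K`. Outside an event of probability at most `η`, `Z n ∈ K` forces `X n ∈ B k` for all large
  -- `n`.
  set B : ℕ → Set E := fun k => closure {f | ∃ n ≥ k, ∃ z ∈ K, R n f z} with hB
  have hBanti : Antitone B := fun k l hkl => closure_mono fun f ⟨n, hn, hf⟩ => ⟨n, hkl.trans hn, hf⟩
  have hBm : ∀ k, NullMeasurableSet (X' ⁻¹' B k) P' := fun k =>
    hX.aemeasurable_limit.nullMeasurableSet_preimage isClosed_closure.measurableSet
  have step : ∀ k, limsup (fun n => P (Z n ⁻¹' K)) atTop ≤ P' (X' ⁻¹' B k) + η := by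
    intro k
    have h1 := ProbabilityMeasure.limsup_measure_closed_le_of_tendsto hX.tendsto
      (isClosed_closure : IsClosed (B k))
    simp only [ProbabilityMeasure.coe_mk] at h1
    rw [Measure.map_apply_of_aemeasurable hX.aemeasurable_limit isClosed_closure.measurableSet] at h1
    simp_rw [fun n => Measure.map_apply_of_aemeasurable (hX.forall_aemeasurable n)
      (isClosed_closure : IsClosed (B k)).measurableSet] at h1
    calc limsup (fun n => P (Z n ⁻¹' K)) atTop
        ≤ limsup (fun n => P (X n ⁻¹' B k) + η) atTop := by
          refine limsup_le_limsup ?_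
          filter_upwards [hR, eventually_ge_atTop k] with n hn hk
          calc P (Z n ⁻¹' K) ≤ P (X n ⁻¹' B k ∪ {ω | ¬ R n (X n ω) (Z n ω)}) := by
                refine measure_mono fun ω hω => ?_
                by_cases hr : R n (X n ω) (Z n ω)
                · exact Or.inl (subset_closure ⟨n, hk, _, hω, hr⟩)
                · exact Or.inr hr
            _ ≤ _ := (measure_union_le _ _).trans (by gcongr)
      _ = limsup (fun n => P (X n ⁻¹' B k)) atTop + η :=
          limsup_add_const atTop _ _ (by isBoundedDefault) (by isBoundedDefault)
      _ ≤ _ := by gcongr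
  -- Letting `k` grow, continuity from above leaves the event that `X'` lies in every `B k`; it
  -- remains to see that this forces `Z' ∈ K` almost surely.
  have hlim2 : Tendsto (fun k => P' (X' ⁻¹' B k) + η) atTop
      (𝓝 (P' (⋂ k, X' ⁻¹' B k) + η)) :=
    (tendsto_measure_iInter_atTop hBm (fun k l hkl => Set.preimage_mono (hBanti hkl))
      ⟨0, measure_ne_top _ _⟩).add_const _
  refine (ge_of_tendsto' hlim2 step).trans ?_
  gcongr ?_ + _
  refine measure_mono_ae ?_
  filter_upwards [hlim] with ω hω hmem
  let := TopologicalSpace.pseudoMetrizableSpacePseudoMetric E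
  -- Membership in all `B k` yields related pairs with indices tending to infinity, paths converging
  -- to `X' ω` and values in the closed set `K`.
  have hex : ∀ k : ℕ, ∃ n ≥ k, ∃ g : E, ∃ z ∈ K, dist (X' ω) g < 1 / ((k : ℝ) + 1) ∧ R n g z := by
    intro k
    have hk : X' ω ∈ B k := Set.mem_iInter.1 hmem k
    obtain ⟨g, ⟨n, hn, z, hz, hr⟩, hd⟩ := Metric.mem_closure_iff.1 hk (1 / ((k : ℝ) + 1))
      (by positivity)
    exact ⟨n, hn, g, z, hz, hd, hr⟩
  choose φ hφ g z hzK hd hr using hex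
  have hz := hω φ g z (tendsto_atTop_mono hφ tendsto_id)
    (tendsto_iff_dist_tendsto_zero.2 (squeeze_zero (fun _ => dist_nonneg)
      (fun k => by rw [dist_comm]; exact (hd k).le) tendsto_one_div_add_atTop_nhds_zero_nat)) hr
  exact hK.mem_of_tendsto hz (Eventually.of_forall hzK)

/-! ### Linear independence of Brownian paths -/

/-- Fubini along a coordinate `k` with `a k ≠ 0`: each fibre of the hyperplane has at most one
point, and the marginals have no atoms. -/
theorem pi_hyperplane_null {n : ℕ} (μ : Fin n → Measure ℝ) [∀ i, IsProbabilityMeasure (μ i)]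
    [∀ i, NullSingletonClass (μ i)] {a : Fin n → ℝ} (ha : a ≠ 0) :
    Measure.pi μ {x | a ⬝ᵥ x = 0} = 0 := by
  obtain ⟨k, hk⟩ := Function.ne_iff.1 ha
  obtain _ | n := n
  · exact k.elim0
  have hS : MeasurableSet {x : Fin (n + 1) → ℝ | a ⬝ᵥ x = 0} :=
    measurableSet_eq_fun (by unfold dotProduct; fun_prop) measurable_const
  rw [← (measurePreserving_piFinSuccAbove μ k).symm.measure_preimage hS.nullMeasurableSet,
    Measure.prod_apply_symm ((MeasurableEquiv.measurable _) hS)]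
  refine (lintegral_congr fun y => ?_).trans lintegral_zero
  refine Set.Subsingleton.measure_zero (fun s hs t ht => ?_) _
  simp only [Set.mem_preimage, Set.mem_ofPred_eq, dotProduct,
    MeasurableEquiv.piFinSuccAbove_symm_apply, Fin.insertNthEquiv_apply,
    Fin.sum_univ_succAbove _ k, Fin.insertNth_apply_same, Fin.insertNth_apply_succAbove] at hs ht
  exact mul_left_cancel₀ hk (by linarith)

/-- Induction by Laplace expansion along the first row. Given the other rows, the determinant is a
linear form in the first one whose coefficients are cofactors. By induction the cofactor at column
zero is almost surely nonzero, and the law of the first row charges no hyperplane. -/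
theorem pi_det_null {n : ℕ} (ν : Fin n → Measure (Fin n → ℝ)) [∀ i, IsProbabilityMeasure (ν i)]
    (hν : ∀ i, ∀ a : Fin n → ℝ, a ≠ 0 → ν i {x | a ⬝ᵥ x = 0} = 0) :
    Measure.pi ν {M | (Matrix.of M).det = 0} = 0 := by
  induction n with
  | zero => simp
  | succ n ih =>
    have hdet : Measurable fun M : Fin (n + 1) → Fin (n + 1) → ℝ => (Matrix.of M).det := by
      have : Continuous fun M : Fin (n + 1) → Fin (n + 1) → ℝ => (Matrix.of M).det :=
        Continuous.matrix_det continuous_id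
      exact this.measurable
    have hS : MeasurableSet {M : Fin (n + 1) → Fin (n + 1) → ℝ | (Matrix.of M).det = 0} :=
      measurableSet_eq_fun hdet measurable_const
    rw [← (measurePreserving_piFinSuccAbove ν 0).symm.measure_preimage hS.nullMeasurableSet,
      Measure.prod_apply_symm ((MeasurableEquiv.measurable _) hS), lintegral_eq_zero_iff
      (measurable_measure_prodMk_right ((MeasurableEquiv.measurable _) hS))]
    have htail : Measurable (fun x : Fin (n + 1) → ℝ => fun i : Fin n => x i.succ) := by fun_prop
    have hp : ∀ i : Fin n, IsProbabilityMeasure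
        ((ν i.succ).map fun x : Fin (n + 1) → ℝ => fun i : Fin n => x i.succ) := fun i =>
      Measure.isProbabilityMeasure_map htail.aemeasurable
    -- Dropping the first coordinate preserves the hyperplane hypothesis: a nonzero `a` extended by
    -- `0` is still nonzero.
    have key := ih (fun i => (ν i.succ).map fun x : Fin (n + 1) → ℝ => fun i : Fin n => x i.succ)
      (fun i a ha => by
        rw [Measure.map_apply htail (measurableSet_eq_fun (by unfold dotProduct; fun_prop)
          measurable_const)]
        convert hν i.succ (Fin.cons 0 a) (fun h => ha (funext fun j => by
          simpa using congrFun h j.succ)) using 2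
        ext x
        simp [dotProduct, Fin.sum_univ_succ])
    rw [← Measure.pi_map_pi (fun i => htail.aemeasurable)] at key
    have hdet' : Measurable fun M : Fin n → Fin n → ℝ => (Matrix.of M).det := by
      have : Continuous fun M : Fin n → Fin n → ℝ => (Matrix.of M).det :=
        Continuous.matrix_det continuous_id
      exact this.measurable
    rw [Measure.map_apply (by fun_prop) (measurableSet_eq_fun hdet' measurable_const)] at key
    have key' : ∀ᵐ y ∂(Measure.pi fun i : Fin n => ν i.succ),
        (Matrix.of fun (i : Fin n) (j : Fin n) => y i j.succ).det ≠ 0 := by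
      rw [ae_iff]
      simpa using key
    have : ∀ᵐ y ∂(Measure.pi fun j : Fin n => ν ((0 : Fin (n + 1)).succAbove j)),
        (Matrix.of fun (i : Fin n) (j : Fin n) => y i j.succ).det ≠ 0 := by
      simpa [Fin.zero_succAbove] using key'
    filter_upwards [this] with y hy
    let cof : Fin (n + 1) → ℝ := fun j => (-1) ^ (j : ℕ) *
      (Matrix.of fun (i : Fin n) (l : Fin n) => y i (j.succAbove l)).det
    have hc : cof ≠ 0 := fun h => hy (by simpa [cof] using congrFun h 0)
    refine measure_mono_null (fun x hx => ?_) (hν 0 cof hc)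
    have hx' : (Matrix.of (Fin.insertNth 0 x y : Fin (n + 1) → Fin (n + 1) → ℝ)).det = 0 := hx
    rw [Matrix.det_succ_row_zero] at hx'
    refine Eq.trans (Finset.sum_congr rfl fun j _ => ?_) hx'
    have : ((Matrix.of (Fin.insertNth 0 x y : Fin (n + 1) → Fin (n + 1) → ℝ)).submatrix Fin.succ
        j.succAbove) = (Matrix.of fun (i : Fin n) (l : Fin n) => y i (j.succAbove l)) := by
      ext i l
      simp
    rw [this]
    simp [cof]
    ring

theorem pi_linearMap_null {n : ℕ} (μ : Fin n → Measure ℝ) [∀ i, IsProbabilityMeasure (μ i)]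
    [∀ i, NullSingletonClass (μ i)] (L : (Fin n → ℝ) →ₗ[ℝ] ℝ) (hL : L ≠ 0) :
    Measure.pi μ {x | L x = 0} = 0 := by
  have h : ∀ x, (fun k => L (Pi.single k 1)) ⬝ᵥ x = L x := fun x => by
    rw [LinearMap.pi_apply_eq_sum_univ L x]
    exact Finset.sum_congr rfl fun k _ => by
      have : (Pi.single k 1 : Fin n → ℝ) = fun l => if k = l then 1 else 0 := by
        ext l
        rw [Pi.single_apply]
        exact if_congr eq_comm rfl rfl
      change L (Pi.single k 1) * x k = _
      rw [this, mul_comm, smul_eq_mul]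
  refine measure_mono_null (fun x hx => (h x).trans hx) (pi_hyperplane_null μ fun h0 => hL (LinearMap.ext fun x => by
    rw [← h, h0, zero_dotProduct, LinearMap.zero_apply]))

/-- The grid on `[0,1]` on which Brownian paths are compared. -/
noncomputable def gridPoint (n k : ℕ) : ℝ≥0 := (k : ℝ≥0) / (2 * n + 1)

theorem gridPoint_strictMono (n : ℕ) : StrictMono (gridPoint n) := fun k l hkl => by
  unfold gridPoint
  gcongr

/-- Second differences of a path along the grid. -/
noncomputable def secondDiff (n : ℕ) (p : ℝ≥0 → ℝ) (j : Fin n) : ℝ :=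
  (p (gridPoint n (2 * j + 2)) - p (gridPoint n (2 * j + 1))) -
    (p (gridPoint n (2 * j + 1)) - p (gridPoint n (2 * j)))

theorem measurable_secondDiff (n : ℕ) : Measurable (secondDiff n) := by
  unfold secondDiff
  fun_prop

/-- The combination is a nonzero linear form in the `2n` grid increments, which are independent
nondegenerate Gaussians. Distinct second differences use disjoint pairs of increments, so no
cancellation between them is possible. -/
theorem map_secondDiff_null {S : Type*} [MeasurableSpace S] {P : Measure S}
    [IsProbabilityMeasure P] {B : ℝ≥0 → S → ℝ} (hB : IsPreBrownianReal B P) {n : ℕ}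
    {a : Fin n → ℝ} (ha : a ≠ 0) : P {ω | a ⬝ᵥ secondDiff n (fun t => B t ω) = 0} = 0 := by
  set D : Fin (2 * n) → S → ℝ := fun k ω => B (gridPoint n (k + 1)) ω - B (gridPoint n k) ω with hD
  have hind : iIndepFun D P :=
    (hB.hasIndepIncrements.nat (gridPoint_strictMono n).monotone).precomp
      (g := fun k : Fin (2 * n) => (k : ℕ)) Fin.val_injective
  have hlaw : ∀ k, P.map (D k) = gaussianReal 0
      (nndist (gridPoint n (k + 1) : ℝ) (gridPoint n k : ℝ)) := fun k => (hB.hasLaw_sub _ _).map_eq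
  have hDm : ∀ k, AEMeasurable (D k) P := fun k => (hB.aemeasurable _).sub (hB.aemeasurable _)
  have hat : ∀ k, NullSingletonClass (P.map (D k)) := fun k => by
    rw [hlaw k]
    refine nullSingletonClass_gaussianReal (fun h => ?_)
    rw [nndist_eq_zero] at h
    exact ((gridPoint_strictMono n) (Nat.lt_succ_self k)).ne' (NNReal.coe_injective h)
  have hpr : ∀ k, IsProbabilityMeasure (P.map (D k)) := fun k =>
    Measure.isProbabilityMeasure_map (hDm k)
  let L : (Fin (2 * n) → ℝ) →ₗ[ℝ] ℝ :=
    ∑ j : Fin n, a j • ((LinearMap.proj ⟨2 * j + 1, by omega⟩ : (Fin (2 * n) → ℝ) →ₗ[ℝ] ℝ) -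
      LinearMap.proj ⟨2 * j, by omega⟩)
  have hLa : ∀ x, L x = ∑ j : Fin n, a j * (x ⟨2 * j + 1, by omega⟩ - x ⟨2 * j, by omega⟩) :=
    fun x => by simp [L]
  have hL : L ≠ 0 := by
    intro h
    obtain ⟨k, hk⟩ := Function.ne_iff.1 ha
    refine hk ?_
    -- Only the `k`-th second difference involves increment `2k + 1`, so this unit vector isolates
    -- `a k`.
    have h1 := LinearMap.congr_fun h (Pi.single ⟨2 * k + 1, by omega⟩ 1)
    rw [hLa, LinearMap.zero_apply, Finset.sum_eq_single k] at h1
    · simpa [Pi.single_apply] using h1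
    · intro j _ hj
      have h2 : (j : ℕ) ≠ k := fun h => hj (Fin.ext h)
      have h3 : ¬ (2 * (j : ℕ) = 2 * k + 1) := by omega
      simp [h2, h3]
    · simp
  have key := pi_linearMap_null (fun k => P.map (D k)) L hL
  rw [← (iIndepFun_iff_map_fun_eq_pi_map hDm).1 hind, Measure.map_apply_of_aemeasurable
    (aemeasurable_pi_lambda _ hDm) (measurableSet_eq_fun
      L.continuous_of_finiteDimensional.measurable measurable_const)] at key
  refine measure_mono_null (fun ω hω => ?_) key
  change L _ = 0
  rw [hLa]
  exact hω

/-- Almost surely, no nontrivial combination of independent Brownian motions is affine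
on `[0,1]`. -/
theorem IsStdBrownian.ae_not_affine {S ι : Type*} [MeasurableSpace S] [Fintype ι] {P : Measure S}
    [IsProbabilityMeasure P] {W : ι → ℝ≥0 → S → ℝ} (hW : IsStdBrownian P W) :
    ∀ᵐ ω ∂P, ∀ (b : ι → ℝ) (c₀ c₁ : ℝ),
      (∀ r ∈ Set.Icc (0 : ℝ) 1, ∑ i, b i * W i r.toNNReal ω = c₀ + c₁ * r) → b = 0 := by
  set n := Fintype.card ι
  let e : Fin n ≃ ι := (Fintype.equivFin ι).symm
  -- As many second differences as there are motions, so that the matrix is square; its rows are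
  -- independent because the motions are.
  set G : Fin n → S → Fin n → ℝ := fun i ω => secondDiff n fun t => W (e i) t ω with hG
  have hGm : ∀ i, AEMeasurable (G i) P := fun i => aemeasurable_pi_lambda _ fun j => by
    have h := fun t => (hW.brownian (e i)).aemeasurable t
    exact ((h _).sub (h _)).sub ((h _).sub (h _))
  have hind : iIndepFun G P :=
    (hW.indep.comp (fun _ => secondDiff n) fun _ => measurable_secondDiff n).precomp e.injective
  have hpr : ∀ k, IsProbabilityMeasure (P.map (G k)) := fun k =>
    Measure.isProbabilityMeasure_map (hGm k)
  have key := pi_det_null (fun i => P.map (G i)) fun i a ha => by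
    rw [Measure.map_apply_of_aemeasurable (hGm i) (measurableSet_eq_fun
      (by unfold dotProduct; fun_prop) measurable_const)]
    exact map_secondDiff_null (hW.brownian (e i)).toIsPreBrownianReal ha
  have hdet : Measurable fun M : Fin n → Fin n → ℝ => (Matrix.of M).det := by
    have : Continuous fun M : Fin n → Fin n → ℝ => (Matrix.of M).det :=
      Continuous.matrix_det continuous_id
    exact this.measurable
  rw [← (iIndepFun_iff_map_fun_eq_pi_map hGm).1 hind, Measure.map_apply_of_aemeasurable
    (aemeasurable_pi_lambda _ hGm) (measurableSet_eq_fun hdet measurable_const)] at key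
  have key' : ∀ᵐ ω ∂P, (Matrix.of fun i => G i ω).det ≠ 0 := by
    rw [ae_iff]
    simpa using key
  filter_upwards [key'] with ω hω b c₀ c₁ hb
  -- Second differences on an equally spaced grid annihilate affine functions, so `b` lies in the
  -- left kernel of an invertible matrix.
  have h0 : (fun i => b (e i)) ᵥ* (Matrix.of fun i => G i ω) = 0 := by
    ext j
    have hgrid : ∀ k ≤ 2 * n, ∑ i, b i * W i (gridPoint n k) ω =
        c₀ + c₁ * (gridPoint n k : ℝ) := fun k hk => by
      have := hb (gridPoint n k) ⟨NNReal.coe_nonneg _, by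
        have h1 : (k : ℝ) ≤ 2 * n := by exact_mod_cast hk
        simp only [gridPoint, NNReal.coe_div, NNReal.coe_natCast, NNReal.coe_add, NNReal.coe_mul,
          NNReal.coe_ofNat, NNReal.coe_one]
        rw [div_le_one (by positivity)]
        linarith⟩
      simpa using this
    have hj := j.2
    have h2 := hgrid (2 * j + 2) (by omega)
    have h1 := hgrid (2 * j + 1) (by omega)
    have h3 := hgrid (2 * j) (by omega)
    have hsum : ∑ i : Fin n, b (e i) * secondDiff n (fun t => W (e i) t ω) j =
        ∑ i, b i * secondDiff n (fun t => W i t ω) j :=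
      e.sum_comp fun i => b i * secondDiff n (fun t => W i t ω) j
    simp only [Matrix.vecMul, dotProduct, Matrix.of_apply, hG, Pi.zero_apply]
    rw [hsum]
    simp only [secondDiff, mul_sub, Finset.sum_sub_distrib]
    rw [h1, h2, h3]
    simp only [gridPoint, NNReal.coe_div]
    push_cast
    ring
  have hz := Matrix.eq_zero_of_vecMul_eq_zero hω h0
  ext i
  simpa using congrFun hz (e.symm i)

/-! ### Convergence of series on the grid `t / T` -/

/-- The series `g k 1, …, g k (φ k)` are uniformly close to the values of `p` on the grid
`t / φ k`. -/
def GridConv (φ : ℕ → ℕ) (g : ℕ → ℕ → ℝ) (p : ℝ → ℝ) : Prop :=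
  ∀ ε : ℝ, 0 < ε → ∀ᶠ k in atTop, ∀ t ∈ Finset.Icc 1 (φ k), |g k t - p (t / φ k)| < ε

theorem grid_mem_Icc {T t : ℕ} (ht : t ∈ Finset.Icc 1 T) : (t / T : ℝ) ∈ Set.Icc (0 : ℝ) 1 := by
  rw [Finset.mem_Icc] at ht
  have h : (t : ℝ) ≤ T := by exact_mod_cast ht.2
  exact ⟨by positivity, div_le_one_of_le₀ h (by positivity)⟩

theorem GridConv.congr {φ : ℕ → ℕ} {g h : ℕ → ℕ → ℝ} {p : ℝ → ℝ} (hg : GridConv φ g p)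
    (hgh : ∀ᶠ k in atTop, ∀ t ∈ Finset.Icc 1 (φ k), h k t = g k t) : GridConv φ h p := by
  intro ε hε
  filter_upwards [hg ε hε, hgh] with k h1 h2 t ht
  rw [h2 t ht]
  exact h1 t ht

theorem GridConv.congr_right {φ : ℕ → ℕ} {g : ℕ → ℕ → ℝ} {p q : ℝ → ℝ} (hg : GridConv φ g p)
    (hpq : ∀ r ∈ Set.Icc (0 : ℝ) 1, p r = q r) : GridConv φ g q := by
  intro ε hε
  filter_upwards [hg ε hε] with k h1 t ht
  rw [← hpq _ (grid_mem_Icc ht)]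
  exact h1 t ht

theorem GridConv.self (φ : ℕ → ℕ) (p : ℝ → ℝ) : GridConv φ (fun k t => p (t / φ k)) p := by
  intro ε hε
  refine Eventually.of_forall fun k t _ => ?_
  simpa using hε

theorem GridConv.const (φ : ℕ → ℕ) {a : ℕ → ℝ} {l : ℝ} (ha : Tendsto a atTop (𝓝 l)) :
    GridConv φ (fun k _ => a k) (fun _ => l) := by
  intro ε hε
  filter_upwards [Metric.tendsto_nhds.1 ha ε hε] with k hk t _
  exact hk

theorem GridConv.add {φ : ℕ → ℕ} {g h : ℕ → ℕ → ℝ} {p q : ℝ → ℝ} (hg : GridConv φ g p)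
    (hh : GridConv φ h q) : GridConv φ (fun k t => g k t + h k t) (fun r => p r + q r) := by
  intro ε hε
  filter_upwards [hg (ε / 2) (by positivity), hh (ε / 2) (by positivity)] with k h1 h2 t ht
  rw [add_sub_add_comm]
  linarith [abs_add_le (g k t - p (t / φ k)) (h k t - q (t / φ k)), h1 t ht, h2 t ht]

theorem exists_bound_of_continuous {p : ℝ → ℝ} (hp : Continuous p) :
    ∃ M : ℝ, 0 < M ∧ ∀ r ∈ Set.Icc (0 : ℝ) 1, |p r| ≤ M := by
  obtain ⟨M, hM⟩ := isCompact_Icc.exists_bound_of_continuousOn (s := Set.Icc (0 : ℝ) 1)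
    hp.continuousOn
  exact ⟨max M 1, by positivity, fun r hr => (hM r hr).trans (le_max_left _ _)⟩

theorem GridConv.mul {φ : ℕ → ℕ} {g h : ℕ → ℕ → ℝ} {p q : ℝ → ℝ} (hg : GridConv φ g p)
    (hh : GridConv φ h q) (hp : Continuous p) (hq : Continuous q) :
    GridConv φ (fun k t => g k t * h k t) (fun r => p r * q r) := by
  intro ε hε
  obtain ⟨M, hM0, hM⟩ := exists_bound_of_continuous hp
  obtain ⟨N, hN0, hN⟩ := exists_bound_of_continuous hq
  -- The third event bounds `h` by `N + 1` on the grid, which is the factor built into the tolerance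
  -- for `g`.
  filter_upwards [hg (min 1 (ε / (2 * (N + 1)))) (by positivity),
    hh (ε / (2 * M)) (by positivity), hh 1 one_pos] with k h1 h2 h3 t ht
  have e : g k t * h k t - p (t / φ k) * q (t / φ k) =
      (g k t - p (t / φ k)) * h k t + p (t / φ k) * (h k t - q (t / φ k)) := by ring
  have b1 : |h k t| ≤ N + 1 := by
    have := abs_add_le (h k t - q (t / φ k)) (q (t / φ k))
    rw [sub_add_cancel] at this
    linarith [h3 t ht, hN _ (grid_mem_Icc ht)]
  have b2 : |g k t - p (t / φ k)| < ε / (2 * (N + 1)) := (h1 t ht).trans_le (min_le_right _ _)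
  rw [e]
  calc _ ≤ |g k t - p (t / φ k)| * |h k t| + |p (t / φ k)| * |h k t - q (t / φ k)| := by
        rw [← abs_mul, ← abs_mul]
        exact abs_add_le _ _
    _ ≤ |g k t - p (t / φ k)| * (N + 1) + M * |h k t - q (t / φ k)| := by
        gcongr
        exact hM _ (grid_mem_Icc ht)
    _ < ε / (2 * (N + 1)) * (N + 1) + M * (ε / (2 * M)) := by
        have := h2 t ht
        gcongr
    _ = ε := by field_simp; ring

theorem GridConv.sum {ι : Type*} {φ : ℕ → ℕ} {g : ι → ℕ → ℕ → ℝ} {p : ι → ℝ → ℝ} (s : Finset ι)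
    (hg : ∀ i ∈ s, GridConv φ (g i) (p i)) :
    GridConv φ (fun k t => ∑ i ∈ s, g i k t) (fun r => ∑ i ∈ s, p i r) := by
  classical
  induction s using Finset.induction_on with
  | empty => simpa using GridConv.const φ (tendsto_const_nhds (x := (0 : ℝ)))
  | insert i s hi ih =>
    simp only [Finset.sum_insert hi]
    exact (hg i (Finset.mem_insert_self i s)).add
      (ih fun j hj => hg j (Finset.mem_insert_of_mem hj))

theorem GridConv.sub {φ : ℕ → ℕ} {g h : ℕ → ℕ → ℝ} {p q : ℝ → ℝ} (hg : GridConv φ g p)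
    (hh : GridConv φ h q) : GridConv φ (fun k t => g k t - h k t) (fun r => p r - q r) := by
  intro ε hε
  filter_upwards [hg (ε / 2) (by positivity), hh (ε / 2) (by positivity)] with k h1 h2 t ht
  rw [sub_sub_sub_comm]
  linarith [abs_sub (g k t - p (t / φ k)) (h k t - q (t / φ k)), h1 t ht, h2 t ht]

/-- Riemann sums of a series close to a continuous path. -/
theorem GridConv.cumulative {φ : ℕ → ℕ} (hφ : Tendsto φ atTop atTop) {g : ℕ → ℕ → ℝ} {p : ℝ → ℝ}
    (hg : GridConv φ g p) (hp : Continuous p) :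
    GridConv φ (fun k t => (φ k : ℝ)⁻¹ * ∑ s ∈ Finset.Icc 1 t, g k s)
      (fun r => ∫ s in (0 : ℝ)..r, p s) := by
  intro ε hε
  obtain ⟨δ, hδ, hunif⟩ := Metric.uniformContinuousOn_iff.1
    (isCompact_Icc.uniformContinuousOn_of_continuous (s := Set.Icc (0 : ℝ) 1) hp.continuousOn)
    (ε / 4) (by positivity)
  have hφ' : ∀ᶠ k in atTop, 1 / δ < (φ k : ℝ) :=
    (tendsto_natCast_atTop_atTop.comp hφ).eventually_gt_atTop _
  filter_upwards [hg (ε / 4) (by positivity), hφ'] with k h1 h2 t ht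
  have hT : (0 : ℝ) < φ k := lt_trans (by positivity) h2
  have hle := (Finset.mem_Icc.1 ht).2
  have hsum : ∑ s ∈ Finset.Icc 1 t, g k s = ∑ s ∈ Finset.range t, g k (s + 1) := by
    rw [Finset.range_eq_Ico, Finset.sum_Ico_add' (fun s => g k s) 0 t 1]
    rfl
  have hint : ∫ s in (0 : ℝ)..(t / φ k : ℝ), p s =
      ∑ s ∈ Finset.range t, ∫ r in ((s : ℝ) / φ k)..(((s + 1 : ℕ) : ℝ) / φ k), p r := by
    rw [intervalIntegral.sum_integral_adjacent_intervals (a := fun s : ℕ => (s : ℝ) / φ k)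
      fun s _ => hp.intervalIntegrable _ _]
    simp
  rw [hsum, hint, Finset.mul_sum, ← Finset.sum_sub_distrib]
  -- On one cell the error is at most `ε/4` from the grid approximation plus `ε/4` from the modulus
  -- of continuity, times the length `1 / φ k`; at most `φ k` cells are added up.
  have hterm : ∀ s ∈ Finset.range t, |(φ k : ℝ)⁻¹ * g k (s + 1) -
      ∫ r in ((s : ℝ) / φ k)..(((s + 1 : ℕ) : ℝ) / φ k), p r| ≤ ε / 2 * (φ k : ℝ)⁻¹ := by
    intro s hs
    have hs' : s + 1 ∈ Finset.Icc 1 (φ k) := by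
      rw [Finset.mem_range] at hs
      rw [Finset.mem_Icc]
      omega
    have hlen : ((s + 1 : ℕ) : ℝ) / φ k - (s : ℝ) / φ k = (φ k : ℝ)⁻¹ := by
      push_cast
      field_simp
      ring
    have e : (φ k : ℝ)⁻¹ * g k (s + 1) -
        ∫ r in ((s : ℝ) / φ k)..(((s + 1 : ℕ) : ℝ) / φ k), p r =
        ∫ r in ((s : ℝ) / φ k)..(((s + 1 : ℕ) : ℝ) / φ k), (g k (s + 1) - p r) := by
      rw [intervalIntegral.integral_sub intervalIntegrable_const (hp.intervalIntegrable _ _),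
        intervalIntegral.integral_const, hlen, smul_eq_mul]
    rw [e, ← Real.norm_eq_abs]
    refine (intervalIntegral.norm_integral_le_of_norm_le_const (C := ε / 2) fun r hr => ?_).trans
      (by rw [hlen, abs_of_pos (inv_pos.2 hT)])
    have hlt : (s : ℝ) / φ k ≤ ((s + 1 : ℕ) : ℝ) / φ k := by
      rw [← sub_nonneg, hlen]
      positivity
    rw [Set.uIoc_of_le hlt] at hr
    have hend := grid_mem_Icc hs'
    have hr0 : 0 ≤ r := le_trans (by positivity) hr.1.le
    have h3 : dist (p (((s + 1 : ℕ) : ℝ) / φ k)) (p r) < ε / 4 := by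
      refine hunif _ hend _ ⟨hr0, hr.2.trans hend.2⟩ ?_
      rw [Real.dist_eq, abs_of_nonneg (sub_nonneg.2 hr.2)]
      have : (φ k : ℝ)⁻¹ < δ := by
        rw [inv_lt_comm₀ hT hδ]
        simpa using h2
      linarith [hr.1]
    rw [Real.dist_eq] at h3
    have h4 := h1 _ hs'
    rw [Real.norm_eq_abs]
    linarith [abs_sub_le (g k (s + 1)) (p (((s + 1 : ℕ) : ℝ) / φ k)) (p r)]
  calc _ ≤ ∑ s ∈ Finset.range t, ε / 2 * (φ k : ℝ)⁻¹ :=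
        (Finset.abs_sum_le_sum_abs _ _).trans (Finset.sum_le_sum hterm)
    _ = ε / 2 * (t / φ k) := by
        rw [Finset.sum_const, Finset.card_range, nsmul_eq_mul]
        ring
    _ ≤ ε / 2 * 1 := by
        gcongr
        exact (grid_mem_Icc ht).2
    _ < ε := by linarith

theorem GridConv.mean {φ : ℕ → ℕ} (hφ : Tendsto φ atTop atTop) {g : ℕ → ℕ → ℝ} {p : ℝ → ℝ}
    (hg : GridConv φ g p) (hp : Continuous p) :
    Tendsto (fun k => (φ k : ℝ)⁻¹ * ∑ s ∈ Finset.Icc 1 (φ k), g k s) atTop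
      (𝓝 (∫ s in (0 : ℝ)..1, p s)) := by
  refine Metric.tendsto_nhds.2 fun ε hε => ?_
  filter_upwards [hg.cumulative hφ hp ε hε, hφ.eventually_ge_atTop 1] with k h1 h2
  have h3 := h1 (φ k) (Finset.mem_Icc.2 ⟨h2, le_rfl⟩)
  rwa [div_self (by positivity)] at h3

/-! ### Limits of least squares residuals and of the variance ratio -/

/-- The Gram matrix of a vector of paths in `L²[0,1]`. -/
noncomputable def gramPath {ι : Type*} (q : ℝ → ι → ℝ) : Matrix ι ι ℝ :=
  Matrix.of fun i j => ∫ s in (0 : ℝ)..1, q s i * q s j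

/-- The moment matrix `∑_{t=1}^T a_t a_t'`. -/
noncomputable def gramSum {ι : Type*} (T : ℕ) (a : ℕ → ι → ℝ) : Matrix ι ι ℝ :=
  ∑ t ∈ Finset.Icc 1 T, Matrix.vecMulVec (a t) (a t)

theorem gramSum_apply {ι : Type*} (T : ℕ) (a : ℕ → ι → ℝ) (i j : ι) :
    gramSum T a i j = ∑ t ∈ Finset.Icc 1 T, a t i * a t j := by
  rw [gramSum, Matrix.sum_apply]
  rfl

section OLS

variable {ι : Type*} [Fintype ι] [DecidableEq ι]

/-- For singular `M` both sides are the default inverse `0`, so no invertibility assumption is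
needed. -/
theorem inv_smul_of_ne_zero {c : ℝ} (hc : c ≠ 0) (M : Matrix ι ι ℝ) : (c • M)⁻¹ = c⁻¹ • M⁻¹ := by
  by_cases h : IsUnit M.det
  · exact Matrix.inv_smul' M (Units.mk0 c hc) h
  · have h' : ¬ IsUnit (c • M).det := by
      rw [Matrix.det_smul]
      intro h'
      exact h (isUnit_of_mul_isUnit_right h')
    rw [Matrix.nonsing_inv_apply_not_isUnit _ h, Matrix.nonsing_inv_apply_not_isUnit _ h',
      smul_zero]

/-- The factor `1 / T` cancels between the moment matrix and the moment vector, turning both into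
averages that converge to integrals. -/
theorem olsCoef_eq_normalized {T : ℕ} (hT : T ≠ 0) (a : ℕ → ι → ℝ) (z : ℕ → ℝ) :
    olsCoef T a z = ((T : ℝ)⁻¹ • gramSum T a)⁻¹ *ᵥ
      ((T : ℝ)⁻¹ • ∑ t ∈ Finset.Icc 1 T, z t • a t) := by
  have hT' : (T : ℝ)⁻¹ ≠ 0 := by positivity
  rw [inv_smul_of_ne_zero hT', Matrix.smul_mulVec, Matrix.mulVec_smul, smul_smul,
    inv_mul_cancel₀ hT', one_smul]
  rfl

theorem tendsto_matrix_inv {M : ℕ → Matrix ι ι ℝ} {Q : Matrix ι ι ℝ}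
    (hM : Tendsto M atTop (𝓝 Q)) (hQ : Q.det ≠ 0) :
    Tendsto (fun k => (M k)⁻¹) atTop (𝓝 Q⁻¹) := by
  simp only [Matrix.inv_def, Ring.inverse_eq_inv']
  exact (((continuous_id.matrix_det).tendsto Q).comp hM).inv₀ hQ |>.smul
    (((continuous_id.matrix_adjugate).tendsto Q).comp hM)

variable {φ : ℕ → ℕ} (hφ : Tendsto φ atTop atTop) {a : ℕ → ℕ → ι → ℝ} {q : ℝ → ι → ℝ}
  (ha : ∀ i, GridConv φ (fun k t => a k t i) (fun r => q r i)) (hq : Continuous q)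

include hφ ha hq

omit [Fintype ι] [DecidableEq ι] in
theorem tendsto_gramSum :
    Tendsto (fun k => (φ k : ℝ)⁻¹ • gramSum (φ k) (a k)) atTop (𝓝 (gramPath q)) := by
  refine tendsto_pi_nhds.2 fun i => tendsto_pi_nhds.2 fun j => ?_
  have h := ((ha i).mul (ha j) (by fun_prop) (by fun_prop)).mean hφ (by fun_prop)
  simpa [gramSum_apply, gramPath] using h

theorem eventually_gramSum_det_ne_zero (hQ : (gramPath q).det ≠ 0) :
    ∀ᶠ k in atTop, (gramSum (φ k) (a k)).det ≠ 0 := by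
  have h := ((continuous_id.matrix_det).tendsto _).comp (tendsto_gramSum hφ ha hq)
  filter_upwards [h.eventually_ne hQ] with k hk h0
  refine hk ?_
  simp [h0]

theorem tendsto_olsCoef {z : ℕ → ℕ → ℝ} {p : ℝ → ℝ} (hz : GridConv φ z p) (hp : Continuous p)
    (hQ : (gramPath q).det ≠ 0) :
    Tendsto (fun k => olsCoef (φ k) (a k) (z k)) atTop
      (𝓝 ((gramPath q)⁻¹ *ᵥ fun i => ∫ s in (0 : ℝ)..1, q s i * p s)) := by
  have hv : Tendsto (fun k => (φ k : ℝ)⁻¹ • ∑ t ∈ Finset.Icc 1 (φ k), z k t • a k t) atTop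
      (𝓝 fun i => ∫ s in (0 : ℝ)..1, q s i * p s) := by
    refine tendsto_pi_nhds.2 fun i => ?_
    have h := ((ha i).mul hz (by fun_prop) hp).mean hφ (by fun_prop)
    simpa [mul_comm] using h
  have hM := tendsto_matrix_inv (tendsto_gramSum hφ ha hq) hQ
  have hc : Continuous fun x : Matrix ι ι ℝ × (ι → ℝ) => x.1 *ᵥ x.2 :=
    continuous_fst.matrix_mulVec continuous_snd
  refine ((hc.tendsto _).comp (hM.prodMk_nhds hv)).congr' ?_
  filter_upwards [hφ.eventually_ne_atTop 0] with k hk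
  rw [olsCoef_eq_normalized hk]
  rfl

/-- The fitted coefficients converge, because matrix inversion is continuous at a nonsingular Gram
matrix, and the residual is built from them by finitely many sums and products. -/
theorem GridConv.olsResid {z : ℕ → ℕ → ℝ} {p : ℝ → ℝ} (hz : GridConv φ z p) (hp : Continuous p)
    (hQ : (gramPath q).det ≠ 0) :
    GridConv φ (fun k => olsResid (φ k) (a k) (z k)) (projectOut q p) := by
  have hb := tendsto_pi_nhds.1 (tendsto_olsCoef hφ ha hq hz hp hQ)
  exact hz.sub (GridConv.sum Finset.univ fun i _ =>
    (ha i).mul (GridConv.const φ (hb i)) (by fun_prop) continuous_const)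

omit hφ ha [DecidableEq ι] in
theorem continuous_projectOut [DecidableEq ι] {p : ℝ → ℝ} (hp : Continuous p) :
    Continuous (projectOut q p) := by
  unfold projectOut
  exact hp.sub (Continuous.dotProduct hq continuous_const)

end OLS

theorem varianceRatio_eq_normalized {T : ℕ} (hT : T ≠ 0) (e : ℕ → ℝ) :
    varianceRatio T e =
      ((T : ℝ)⁻¹ * ∑ t ∈ Finset.Icc 1 T, ((T : ℝ)⁻¹ * ∑ s ∈ Finset.Icc 1 t, e s) ^ 2) /
        ((T : ℝ)⁻¹ * ∑ t ∈ Finset.Icc 1 T, e t ^ 2) := by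
  have hT' : (T : ℝ) ≠ 0 := by positivity
  simp only [varianceRatio, mul_pow, ← Finset.mul_sum]
  rw [mul_div_mul_left _ _ (inv_ne_zero hT'), inv_pow]

theorem GridConv.varianceRatio {φ : ℕ → ℕ} (hφ : Tendsto φ atTop atTop) {e : ℕ → ℕ → ℝ}
    {p : ℝ → ℝ} (he : GridConv φ e p) (hp : Continuous p)
    (h0 : ∫ r in (0 : ℝ)..1, p r ^ 2 ≠ 0) :
    Tendsto (fun k => varianceRatio (φ k) (e k)) atTop
      (𝓝 ((∫ r in (0 : ℝ)..1, (∫ s in (0 : ℝ)..r, p s) ^ 2) / ∫ r in (0 : ℝ)..1, p r ^ 2)) := by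
  have hP : Continuous fun r => ∫ s in (0 : ℝ)..r, p s :=
    intervalIntegral.continuous_primitive (fun _ _ => hp.intervalIntegrable _ _) 0
  have h1 := he.cumulative hφ hp
  have h2 := (h1.mul h1 hP hP).mean hφ (hP.mul hP)
  have h3 := (he.mul he hp hp).mean hφ (hp.mul hp)
  simp only [← sq] at h2 h3
  refine (h2.div h3 h0).congr' ?_
  filter_upwards [hφ.eventually_ne_atTop 0] with k hk
  rw [varianceRatio_eq_normalized hk]
  rfl

/-! ### Finite sample invariance of least squares residuals -/

section OLSInvariance

variable {ι : Type*} [Fintype ι] [DecidableEq ι] {T : ℕ}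

theorem olsCoef_congr {a a' : ℕ → ι → ℝ} {z z' : ℕ → ℝ}
    (ha : ∀ t ∈ Finset.Icc 1 T, a t = a' t) (hz : ∀ t ∈ Finset.Icc 1 T, z t = z' t) :
    olsCoef T a z = olsCoef T a' z' := by
  unfold olsCoef
  rw [Finset.sum_congr rfl fun t ht => by rw [ha t ht], Finset.sum_congr (g := fun t => z' t • a' t)
    rfl fun t ht => by rw [ha t ht, hz t ht]]

theorem olsResid_congr {a a' : ℕ → ι → ℝ} {z z' : ℕ → ℝ}
    (ha : ∀ t ∈ Finset.Icc 1 T, a t = a' t) (hz : ∀ t ∈ Finset.Icc 1 T, z t = z' t) :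
    ∀ t ∈ Finset.Icc 1 T, olsResid T a z t = olsResid T a' z' t := by
  intro t ht
  rw [olsResid, olsResid, olsCoef_congr ha hz, ha t ht, hz t ht]

theorem olsCoef_add (a : ℕ → ι → ℝ) (z z' : ℕ → ℝ) :
    olsCoef T a (fun t => z t + z' t) = olsCoef T a z + olsCoef T a z' := by
  simp only [olsCoef, add_smul, Finset.sum_add_distrib, Matrix.mulVec_add]

theorem olsCoef_const_mul (a : ℕ → ι → ℝ) (c : ℝ) (z : ℕ → ℝ) :
    olsCoef T a (fun t => c * z t) = c • olsCoef T a z := by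
  simp only [olsCoef, mul_smul, ← Finset.smul_sum, Matrix.mulVec_smul]

theorem olsResid_add (a : ℕ → ι → ℝ) (z z' : ℕ → ℝ) (t : ℕ) :
    olsResid T a (fun t => z t + z' t) t = olsResid T a z t + olsResid T a z' t := by
  simp only [olsResid, olsCoef_add, dotProduct_add]
  ring

theorem olsResid_const_mul (a : ℕ → ι → ℝ) (c : ℝ) (z : ℕ → ℝ) (t : ℕ) :
    olsResid T a (fun t => c * z t) t = c * olsResid T a z t := by
  simp only [olsResid, olsCoef_const_mul, dotProduct_smul, smul_eq_mul]
  ring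

theorem olsResid_sum {κ : Type*} (s : Finset κ) (a : ℕ → ι → ℝ) (z : κ → ℕ → ℝ) (t : ℕ) :
    olsResid T a (fun t => ∑ i ∈ s, z i t) t = ∑ i ∈ s, olsResid T a (z i) t := by
  classical
  induction s using Finset.induction_on with
  | empty =>
    simpa using olsResid_const_mul (T := T) a 0 (fun _ => 0) t
  | insert i s hi ih =>
    simp only [Finset.sum_insert hi]
    rw [olsResid_add, ih]

theorem olsResid_dotProduct {a : ℕ → ι → ℝ} (h : (gramSum T a).det ≠ 0) (b : ι → ℝ) (t : ℕ) :
    olsResid T a (fun t => a t ⬝ᵥ b) t = 0 := by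
  have h1 : ∑ t ∈ Finset.Icc 1 T, (a t ⬝ᵥ b) • a t = gramSum T a *ᵥ b := by
    rw [gramSum, Matrix.sum_mulVec]
    refine Finset.sum_congr rfl fun t _ => ?_
    rw [Matrix.vecMulVec_mulVec]
    simp
  rw [olsResid, olsCoef, h1]
  change a t ⬝ᵥ b - a t ⬝ᵥ ((gramSum T a)⁻¹ *ᵥ _) = 0
  rw [Matrix.mulVec_mulVec, Matrix.nonsing_inv_mul _ (isUnit_iff_ne_zero.2 h), Matrix.one_mulVec,
    sub_self]

/-- Least squares residuals do not depend on the basis of the space of regressors. -/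
theorem olsResid_mulVec {A : Matrix ι ι ℝ} (hA : A.det ≠ 0) (a : ℕ → ι → ℝ) (z : ℕ → ℝ) (t : ℕ) :
    olsResid T (fun t => A *ᵥ a t) z t = olsResid T a z t := by
  have hA' := isUnit_iff_ne_zero.2 hA
  have h1 : ∑ t ∈ Finset.Icc 1 T, Matrix.vecMulVec (A *ᵥ a t) (A *ᵥ a t) =
      A * gramSum T a * Aᵀ := by
    rw [gramSum, Finset.mul_sum, Finset.sum_mul]
    refine Finset.sum_congr rfl fun t _ => ?_
    rw [Matrix.mul_vecMulVec, Matrix.vecMulVec_mul, Matrix.vecMul_transpose]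
  have h2 : ∑ t ∈ Finset.Icc 1 T, z t • (A *ᵥ a t) = A *ᵥ ∑ t ∈ Finset.Icc 1 T, z t • a t := by
    simp only [← Matrix.mulVec_smul, Matrix.mulVec_sum]
  simp only [olsResid, olsCoef]
  rw [h1, h2, Matrix.mul_inv_rev, Matrix.mul_inv_rev, Matrix.mulVec_mulVec, Matrix.mul_assoc,
    Matrix.mul_assoc, Matrix.nonsing_inv_mul _ hA', Matrix.mul_one, ← Matrix.mulVec_mulVec,
    ← Matrix.transpose_nonsing_inv, Matrix.mulVec_transpose, dotProduct_comm,
    ← Matrix.dotProduct_mulVec, Matrix.mulVec_mulVec, Matrix.nonsing_inv_mul _ hA',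
    Matrix.one_mulVec, dotProduct_comm]
  rfl

end OLSInvariance

theorem detrend_congr (c : DetCase) {T : ℕ} {z z' : ℕ → ℝ}
    (hz : ∀ t ∈ Finset.Icc 1 T, z t = z' t) :
    ∀ t ∈ Finset.Icc 1 T, detrend c T z t = detrend c T z' t :=
  olsResid_congr (fun _ _ => rfl) hz

/-- The moment matrix transforms as `A G Aᵀ`; this carries nonsingularity from rescaled
deterministic regressors back to the original ones. -/
theorem gramSum_mulVec_det {ι : Type*} [Fintype ι] [DecidableEq ι] {T : ℕ} {A : Matrix ι ι ℝ}
    (a : ℕ → ι → ℝ) (h : (gramSum T fun t => A *ᵥ a t).det ≠ 0) : (gramSum T a).det ≠ 0 := by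
  have h1 : (gramSum T fun t => A *ᵥ a t) = A * gramSum T a * Aᵀ := by
    rw [gramSum, gramSum, Finset.mul_sum, Finset.sum_mul]
    refine Finset.sum_congr rfl fun t _ => ?_
    rw [Matrix.mul_vecMulVec, Matrix.vecMulVec_mul, Matrix.vecMul_transpose]
  intro h0
  rw [h1, Matrix.det_mul, Matrix.det_mul, h0] at h
  simp at h

/-- Invariance of the residuals under the parameters of the model. -/
theorem residual_eq {c : DetCase} {m T : ℕ} {x X : ℕ → Fin m → ℝ} {y Z : ℕ → ℝ}
    {A : Matrix (Fin m) (Fin m) ℝ} {B : Fin m → Fin c.dim → ℝ} {κ : ℝ} {β : Fin m → ℝ}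
    {τ : Fin c.dim → ℝ} (hA : A.det ≠ 0) (hd : (gramSum T c.det).det ≠ 0)
    (hX : (gramSum T fun t i => detrend c T (fun s => X s i) t).det ≠ 0)
    (hx : ∀ t ∈ Finset.Icc 1 T, ∀ i, x t i = (A *ᵥ X t) i + c.det t ⬝ᵥ B i)
    (hy : ∀ t ∈ Finset.Icc 1 T, y t = κ * Z t + X t ⬝ᵥ β + c.det t ⬝ᵥ τ) :
    ∀ t ∈ Finset.Icc 1 T, residual c T x y t = κ * residual c T X Z t := by
  -- Detrending is linear and annihilates the combinations of `c.det`, so only the change of basis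
  -- `A` survives.
  have hdx : ∀ t ∈ Finset.Icc 1 T, (fun i => detrend c T (fun s => x s i) t) =
      A *ᵥ fun i => detrend c T (fun s => X s i) t := by
    intro t ht
    ext i
    rw [detrend_congr c (fun s hs => hx s hs i) t ht, detrend, olsResid_add,
      olsResid_dotProduct hd, add_zero]
    simp only [Matrix.mulVec, dotProduct]
    rw [olsResid_sum]
    simp only [olsResid_const_mul]
    rfl
  have hdy : ∀ t ∈ Finset.Icc 1 T, detrend c T y t = κ * detrend c T Z t +
      (fun i => detrend c T (fun s => X s i) t) ⬝ᵥ β := by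
    intro t ht
    rw [detrend_congr c hy t ht, detrend, olsResid_add, olsResid_dotProduct hd, add_zero,
      olsResid_add, olsResid_const_mul]
    simp only [dotProduct]
    rw [olsResid_sum]
    simp only [mul_comm _ (β _), olsResid_const_mul]
    rfl
  intro t ht
  -- In the second regression, the change of basis has no effect and the part of `y` along the
  -- detrended regressors is removed; only the factor `κ` remains.
  rw [residual, olsResid_congr hdx hdy t ht, olsResid_mulVec hA, olsResid_add,
    olsResid_dotProduct hX, add_zero, olsResid_const_mul]
  rfl

theorem varianceRatio_const_mul {T : ℕ} {κ : ℝ} (hκ : κ ≠ 0) {e e' : ℕ → ℝ}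
    (h : ∀ t ∈ Finset.Icc 1 T, e t = κ * e' t) : varianceRatio T e = varianceRatio T e' := by
  have h1 : ∀ t ∈ Finset.Icc 1 T, ∑ s ∈ Finset.Icc 1 t, e s = κ * ∑ s ∈ Finset.Icc 1 t, e' s := by
    intro t ht
    rw [Finset.mul_sum]
    refine Finset.sum_congr rfl fun s hs => h s ?_
    simp only [Finset.mem_Icc] at *
    omega
  have h2 : ∑ t ∈ Finset.Icc 1 T, e t ^ 2 = ∑ t ∈ Finset.Icc 1 T, (κ * e' t) ^ 2 :=
    Finset.sum_congr rfl fun t ht => by rw [h t ht]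
  have h3 : ∑ t ∈ Finset.Icc 1 T, (∑ s ∈ Finset.Icc 1 t, e s) ^ 2 =
      ∑ t ∈ Finset.Icc 1 T, (κ * ∑ s ∈ Finset.Icc 1 t, e' s) ^ 2 :=
    Finset.sum_congr rfl fun t ht => by rw [h1 t ht]
  rw [varianceRatio, varianceRatio, h2, h3]
  simp only [mul_pow, ← Finset.mul_sum]
  rw [mul_left_comm, mul_div_mul_left _ _ (pow_ne_zero 2 hκ)]

/-! ### Limits of detrended series -/

/-- The path version of the deterministic component. -/
noncomputable def DetCase.detPath : (c : DetCase) → ℝ → Fin c.dim → ℝ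
  | .D0, _ => ![]
  | .D1, _ => ![1]
  | .D2, r => ![1, r]

/-- The scaling matrix of the deterministic component. -/
noncomputable def DetCase.scale : (c : DetCase) → ℕ → Matrix (Fin c.dim) (Fin c.dim) ℝ
  | .D0, _ => 1
  | .D1, _ => 1
  | .D2, T => !![1, 0; 0, (T : ℝ)⁻¹]

theorem DetCase.scale_mulVec (c : DetCase) (T t : ℕ) :
    c.scale T *ᵥ c.det t = c.detPath (t / T) := by
  cases c
  · exact Subsingleton.elim _ _
  · simp [DetCase.scale, DetCase.det, DetCase.detPath]
  · ext i
    fin_cases i <;> simp [DetCase.scale, DetCase.det, DetCase.detPath, Matrix.mulVec, dotProduct,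
      div_eq_inv_mul]

theorem DetCase.scale_det (c : DetCase) {T : ℕ} (hT : T ≠ 0) : (c.scale T).det ≠ 0 := by
  cases c <;> simp [DetCase.scale, Matrix.det_fin_two, hT]

theorem DetCase.continuous_detPath (c : DetCase) : Continuous c.detPath := by
  refine continuous_pi fun i => ?_
  cases c
  · exact i.elim0
  · exact continuous_const
  · fin_cases i
    · exact continuous_const
    · exact continuous_id

theorem gramPath_detPath_two : gramPath (DetCase.detPath .D2) = !![1, 1 / 2; 1 / 2, 1 / 3] := by
  have h2 : ∫ s in (0 : ℝ)..1, s * s = 1 / 3 := by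
    simp only [← sq, integral_pow]
    norm_num
  ext i j
  fin_cases i <;> fin_cases j <;> simp [gramPath, DetCase.detPath, h2]

theorem DetCase.gramPath_detPath_det (c : DetCase) : (gramPath c.detPath).det ≠ 0 := by
  cases c
  · simp
  · simp [gramPath, DetCase.detPath]
  · rw [gramPath_detPath_two, Matrix.det_fin_two]
    norm_num

/-- The weights `4 - 6r` and `12r - 6` are the entries of `[1, r]` times the inverse of the Gram
matrix of `1, r`, which is `!![4, -6; -6, 12]`. -/
theorem projectOut_detPath (c : DetCase) (p : ℝ → ℝ) :
    projectOut c.detPath p = detrendPath c p := by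
  ext r
  change p r - c.detPath r ⬝ᵥ ((gramPath c.detPath)⁻¹ *ᵥ
    fun i => ∫ s in (0 : ℝ)..1, c.detPath s i * p s) = _
  cases c
  · simp [detrendPath, dotProduct]
  · have h : gramPath (DetCase.detPath .D1) = 1 := by
      ext i j
      fin_cases i
      fin_cases j
      simp [gramPath, DetCase.detPath]
    rw [h]
    simp [detrendPath, DetCase.detPath, dotProduct]
  · have h : (gramPath (DetCase.detPath .D2))⁻¹ = !![4, -6; -6, 12] := by
      rw [gramPath_detPath_two]
      refine Matrix.inv_eq_right_inv ?_
      ext i j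
      fin_cases i <;> fin_cases j <;> norm_num [Matrix.mul_apply, Fin.sum_univ_two]
    rw [h]
    simp [detrendPath, DetCase.detPath, dotProduct, Matrix.mulVec, Fin.sum_univ_two]
    ring

theorem continuous_detrendPath (c : DetCase) {p : ℝ → ℝ} (hp : Continuous p) :
    Continuous (detrendPath c p) := by
  rw [← projectOut_detPath]
  exact continuous_projectOut c.continuous_detPath hp

theorem gridConv_detPath (c : DetCase) (φ : ℕ → ℕ) (i : Fin c.dim) :
    GridConv φ (fun k t => (c.scale (φ k) *ᵥ c.det t) i) (fun r => c.detPath r i) := by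
  simp only [DetCase.scale_mulVec]
  exact GridConv.self φ fun r => c.detPath r i

theorem eventually_gramSum_det (c : DetCase) {φ : ℕ → ℕ} (hφ : Tendsto φ atTop atTop) :
    ∀ᶠ k in atTop, (gramSum (φ k) c.det).det ≠ 0 :=
  (eventually_gramSum_det_ne_zero hφ (gridConv_detPath c φ) c.continuous_detPath
    c.gramPath_detPath_det).mono fun _ hk => gramSum_mulVec_det _ hk

/-- Replacing the trend `t` by `t / T` is an invertible change of regressors: it leaves the
residuals alone and makes the regressors converge on the grid. -/
theorem GridConv.detrend (c : DetCase) {φ : ℕ → ℕ} (hφ : Tendsto φ atTop atTop)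
    {z : ℕ → ℕ → ℝ} {p : ℝ → ℝ} (hz : GridConv φ z p) (hp : Continuous p) :
    GridConv φ (fun k => detrend c (φ k) (z k)) (detrendPath c p) := by
  have h := GridConv.olsResid hφ (gridConv_detPath c φ) c.continuous_detPath hz hp
    c.gramPath_detPath_det
  rw [projectOut_detPath] at h
  refine h.congr ?_
  filter_upwards [hφ.eventually_ne_atTop 0] with k hk t _
  rw [olsResid_mulVec (c.scale_det hk)]
  rfl

/-! ### Nondegeneracy of the limit -/

theorem eq_zero_of_integral_sq_eq_zero {h : ℝ → ℝ} (hc : Continuous h)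
    (h0 : ∫ r in (0 : ℝ)..1, h r ^ 2 = 0) : ∀ r ∈ Set.Icc (0 : ℝ) 1, h r = 0 := by
  intro r hr
  by_contra hne
  have := intervalIntegral.integral_pos (f := fun r => h r ^ 2) one_pos (hc.pow 2).continuousOn
    (fun _ _ => sq_nonneg _) ⟨r, hr, by positivity⟩
  exact this.ne' h0

theorem dotProduct_gramPath {ι : Type*} [Fintype ι] {q : ℝ → ι → ℝ} (hq : Continuous q)
    (b : ι → ℝ) : b ⬝ᵥ (gramPath q *ᵥ b) = ∫ r in (0 : ℝ)..1, (∑ i, b i * q r i) ^ 2 := by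
  have h : ∀ i j, IntervalIntegrable (fun r => (b i * q r i) * (b j * q r j)) volume 0 1 :=
    fun i j => Continuous.intervalIntegrable (by fun_prop) _ _
  simp only [sq, Finset.sum_mul_sum]
  rw [intervalIntegral.integral_finsetSum fun i _ =>
    Continuous.intervalIntegrable (by fun_prop) _ _]
  simp only [dotProduct, Matrix.mulVec, gramPath, Matrix.of_apply, Finset.mul_sum]
  refine Finset.sum_congr rfl fun i _ => ?_
  rw [intervalIntegral.integral_finsetSum fun j _ => h i j]
  refine Finset.sum_congr rfl fun j _ => ?_
  rw [← intervalIntegral.integral_mul_const, ← intervalIntegral.integral_const_mul]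
  congr 1
  ext r
  ring

/-- A null vector `b` of the Gram matrix makes `∫ (b'q)²` vanish, hence `b'q` vanishes on `[0,1]` by
continuity. -/
theorem gramPath_det_ne_zero {ι : Type*} [Fintype ι] [DecidableEq ι] {q : ℝ → ι → ℝ}
    (hq : Continuous q)
    (h : ∀ b : ι → ℝ, (∀ r ∈ Set.Icc (0 : ℝ) 1, ∑ i, b i * q r i = 0) → b = 0) :
    (gramPath q).det ≠ 0 := by
  intro h0
  obtain ⟨b, hb, hb0⟩ := Matrix.exists_mulVec_eq_zero_iff.2 h0
  refine hb (h b (eq_zero_of_integral_sq_eq_zero (by fun_prop) ?_))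
  rw [← dotProduct_gramPath hq, hb0, dotProduct_zero]

theorem exists_detrendPath_eq (c : DetCase) (p : ℝ → ℝ) :
    ∃ c₀ c₁ : ℝ, ∀ r, detrendPath c p r = p r - (c₀ + c₁ * r) := by
  cases c
  · exact ⟨0, 0, fun r => by simp [detrendPath]⟩
  · exact ⟨∫ s in (0 : ℝ)..1, p s, 0, fun r => by simp [detrendPath]⟩
  · exact ⟨4 * (∫ s in (0 : ℝ)..1, p s) - 6 * ∫ s in (0 : ℝ)..1, s * p s,
      -6 * (∫ s in (0 : ℝ)..1, p s) + 12 * ∫ s in (0 : ℝ)..1, s * p s, fun r => by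
        simp only [detrendPath]
        ring⟩

/-- Detrended paths are linearly independent if no nontrivial combination of the paths is
affine. -/
theorem detrendPath_independent {ι : Type*} [Fintype ι] (c : DetCase) {w : ι → ℝ → ℝ}
    (hw : ∀ (b : ι → ℝ) (c₀ c₁ : ℝ),
      (∀ r ∈ Set.Icc (0 : ℝ) 1, ∑ i, b i * w i r = c₀ + c₁ * r) → b = 0)
    (b : ι → ℝ) (hb : ∀ r ∈ Set.Icc (0 : ℝ) 1, ∑ i, b i * detrendPath c (w i) r = 0) : b = 0 := by
  choose c₀ c₁ h using fun i => exists_detrendPath_eq c (w i)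
  refine hw b (∑ i, b i * c₀ i) (∑ i, b i * c₁ i) fun r hr => ?_
  have h1 := hb r hr
  simp only [h, mul_sub, mul_add, Finset.sum_sub_distrib, Finset.sum_add_distrib] at h1
  rw [Finset.sum_mul]
  simp only [mul_assoc]
  linarith

section Limit

variable {m : ℕ} (c : DetCase) {w : Idx m → ℝ → ℝ} (hwc : ∀ i, Continuous (w i))
  (hw : ∀ (b : Idx m → ℝ) (c₀ c₁ : ℝ),
    (∀ r ∈ Set.Icc (0 : ℝ) 1, ∑ i, b i * w i r = c₀ + c₁ * r) → b = 0)

include hwc in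
theorem continuous_detrended_regressor :
    Continuous fun r => fun i : Fin m => detrendPath c (w (Sum.inr i)) r :=
  continuous_pi fun _ => continuous_detrendPath c (hwc _)

include hwc hw

theorem gramPath_detrended_regressor_det :
    (gramPath fun r => fun i : Fin m => detrendPath c (w (Sum.inr i)) r).det ≠ 0 := by
  refine gramPath_det_ne_zero (continuous_detrended_regressor c hwc) fun b hb => ?_
  have h := detrendPath_independent c hw (Sum.elim (fun _ => 0) b) fun r hr => by
    simpa using hb r hr
  ext i
  simpa using congrFun h (Sum.inr i)

/-- Otherwise the projection residual would vanish identically, a linear relation among the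
detrended paths in which the `inl` path has coefficient `1`. -/
theorem integral_projectOut_sq_ne_zero :
    ∫ r in (0 : ℝ)..1, projectOut (fun r => fun i : Fin m => detrendPath c (w (Sum.inr i)) r)
      (detrendPath c (w (Sum.inl ()))) r ^ 2 ≠ 0 := by
  intro h0
  have h1 := eq_zero_of_integral_sq_eq_zero
    (continuous_projectOut (continuous_detrended_regressor c hwc)
      (continuous_detrendPath c (hwc _))) h0
  set γ := (Matrix.of fun i j : Fin m => ∫ s in (0 : ℝ)..1,
    detrendPath c (w (Sum.inr i)) s * detrendPath c (w (Sum.inr j)) s)⁻¹ *ᵥ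
    fun i => ∫ s in (0 : ℝ)..1, detrendPath c (w (Sum.inr i)) s * detrendPath c (w (Sum.inl ())) s
    with hγ
  have h := detrendPath_independent c hw (Sum.elim (fun _ => 1) (fun i => -γ i)) fun r hr => by
    have h2 : detrendPath c (w (Sum.inl ())) r -
      (fun i : Fin m => detrendPath c (w (Sum.inr i)) r) ⬝ᵥ γ = 0 := h1 r hr
    simp only [dotProduct] at h2
    simp only [Fintype.sum_sum_type, Finset.univ_unique, Finset.sum_singleton, Sum.elim_inl,
      Sum.elim_inr, one_mul, neg_mul, Finset.sum_neg_distrib]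
    simp only [mul_comm (γ _)]
    exact h2
  simpa using congrFun h (Sum.inl ())

/-- If the scaled series converge uniformly to nondegenerate paths, the variance ratio of the
regression residuals converges. -/
theorem tendsto_varianceRatio_residual {φ : ℕ → ℕ} (hφ : Tendsto φ atTop atTop)
    {X : ℕ → ℕ → Fin m → ℝ} {Z : ℕ → ℕ → ℝ}
    (hX : ∀ i, GridConv φ (fun k t => X k t i) (w (Sum.inr i)))
    (hZ : GridConv φ Z (w (Sum.inl ()))) :
    (∀ᶠ k in atTop, (gramSum (φ k) fun t i =>
      VarianceRatio.detrend c (φ k) (fun s => X k s i) t).det ≠ 0) ∧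
    Tendsto (fun k => varianceRatio (φ k) (residual c (φ k) (X k) (Z k))) atTop
      (𝓝 ((∫ r in (0 : ℝ)..1, (∫ s in (0 : ℝ)..r, projectOut
          (fun r => fun i : Fin m => detrendPath c (w (Sum.inr i)) r)
          (detrendPath c (w (Sum.inl ()))) s) ^ 2) /
        ∫ r in (0 : ℝ)..1, projectOut (fun r => fun i : Fin m => detrendPath c (w (Sum.inr i)) r)
          (detrendPath c (w (Sum.inl ()))) r ^ 2)) := by
  have hq := continuous_detrended_regressor c hwc
  have hdX := fun i => (hX i).detrend c hφ (hwc _)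
  have hdZ := hZ.detrend c hφ (hwc _)
  have hG := gramPath_detrended_regressor_det c hwc hw
  have hp := continuous_detrendPath c (hwc (Sum.inl ()))
  refine ⟨eventually_gramSum_det_ne_zero hφ hdX hq hG, ?_⟩
  exact (GridConv.olsResid hφ hdX hq hdZ hp hG).varianceRatio hφ (continuous_projectOut hq hp)
    (integral_projectOut_sq_ne_zero c hwc hw)

end Limit

/-! ### Measurability -/

section Measurability

variable {S ι : Type*} [MeasurableSpace S] [Fintype ι] [DecidableEq ι]

theorem measurable_matrix_det {M : S → Matrix ι ι ℝ} (hM : ∀ i j, Measurable fun ω => M ω i j) :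
    Measurable fun ω => (M ω).det := by
  simp only [Matrix.det_apply]
  exact Finset.measurable_sum _ fun _ _ =>
    (Finset.measurable_prod _ fun i _ => hM _ _).const_smul _

/-- The formula by adjugate and inverted determinant holds for the total inverse, so measurability
covers singular matrices too. -/
theorem measurable_matrix_inv_apply {M : S → Matrix ι ι ℝ}
    (hM : ∀ i j, Measurable fun ω => M ω i j) (i j : ι) : Measurable fun ω => (M ω)⁻¹ i j := by
  simp only [Matrix.inv_def, Ring.inverse_eq_inv', Matrix.smul_apply, smul_eq_mul,
    Matrix.adjugate_apply]
  refine (measurable_matrix_det hM).inv.mul (measurable_matrix_det fun k l => ?_)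
  by_cases h : k = j
  · simp [h]
  · simpa [Matrix.updateRow_apply, h] using hM k l

theorem measurable_olsResid {T : ℕ} {a : ℕ → S → ι → ℝ} {z : ℕ → S → ℝ}
    (ha : ∀ t ∈ Finset.Icc 1 T, ∀ i, Measurable fun ω => a t ω i)
    (hz : ∀ t ∈ Finset.Icc 1 T, Measurable (z t)) :
    ∀ t ∈ Finset.Icc 1 T,
      Measurable fun ω => olsResid T (fun s => a s ω) (fun s => z s ω) t := by
  intro t ht
  have hM : ∀ i j, Measurable fun ω => gramSum T (fun s => a s ω) i j := fun i j => by
    simp only [gramSum_apply]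
    exact Finset.measurable_sum _ fun s hs => (ha s hs i).mul (ha s hs j)
  have hv : ∀ i, Measurable fun ω => (∑ s ∈ Finset.Icc 1 T, z s ω • a s ω) i := fun i => by
    simp only [Finset.sum_apply, Pi.smul_apply, smul_eq_mul]
    exact Finset.measurable_sum _ fun s hs => (hz s hs).mul (ha s hs i)
  exact (hz t ht).sub (Finset.measurable_sum _ fun i _ => (ha t ht i).mul
    (Finset.measurable_sum _ fun j _ => (measurable_matrix_inv_apply hM i j).mul (hv j)))

theorem measurable_varianceRatio_residual (c : DetCase) {m T : ℕ} {x : ℕ → S → Fin m → ℝ}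
    {y : ℕ → S → ℝ} (hx : ∀ t ∈ Finset.Icc 1 T, ∀ i, Measurable fun ω => x t ω i)
    (hy : ∀ t ∈ Finset.Icc 1 T, Measurable (y t)) :
    Measurable fun ω => varianceRatio T (residual c T (fun t => x t ω) fun t => y t ω) := by
  have hres : ∀ t ∈ Finset.Icc 1 T,
      Measurable fun ω => residual c T (fun t => x t ω) (fun t => y t ω) t := by
    refine measurable_olsResid
      (a := fun t ω i => detrend c T (fun s => x s ω i) t)
      (z := fun t ω => detrend c T (fun s => y s ω) t) (fun t ht i => ?_) fun t ht => ?_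
    · exact measurable_olsResid (a := fun t _ => c.det t) (z := fun s ω => x s ω i)
        (fun _ _ _ => measurable_const) (fun s hs => hx s hs i) t ht
    · exact measurable_olsResid (a := fun t _ => c.det t)
        (fun _ _ _ => measurable_const) hy t ht
  refine Measurable.div (measurable_const.mul (Finset.measurable_sum _ fun t ht =>
    (Finset.measurable_sum _ fun s hs => hres s ?_).pow_const 2))
    (Finset.measurable_sum _ fun t ht => (hres t ht).pow_const 2)
  simp only [Finset.mem_Icc] at *
  omega

end Measurability

/-! ### The triangular square root -/

/-- Schur complement: `det Ω = det Ω_vv · Ω_{ξ·v}`, and both determinants are positive. -/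
theorem condVariance_pos {m : ℕ} {Om : Matrix (Idx m) (Idx m) ℝ} (h : Om.PosDef) :
    0 < condVariance Om := by
  have hD : Om.toBlocks₂₂.PosDef := h.submatrix Sum.inr_injective
  have hD' := hD.det_pos
  let := Matrix.invertibleOfIsUnitDet _ (isUnit_iff_ne_zero.2 hD'.ne')
  have h1 := h.det_pos
  rw [← Matrix.fromBlocks_toBlocks Om, Matrix.det_fromBlocks₂₂, Matrix.invOf_eq_nonsing_inv] at h1
  have h2 := pos_of_mul_pos_right h1 hD'.le
  simpa [condVariance, Matrix.det_unique] using h2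

theorem det_ne_zero_of_root {m : ℕ} {Om : Matrix (Idx m) (Idx m) ℝ} (h : Om.PosDef)
    {C : Matrix (Fin m) (Fin m) ℝ} (hC : C * Cᵀ = Om.toBlocks₂₂) : C.det ≠ 0 := by
  have hD : Om.toBlocks₂₂.PosDef := h.submatrix Sum.inr_injective
  intro h0
  have h1 := hD.det_pos
  rw [← hC, Matrix.det_mul, h0, zero_mul] at h1
  exact h1.false

theorem triangularRoot_mulVec_inl {m : ℕ} (Om : Matrix (Idx m) (Idx m) ℝ)
    (C : Matrix (Fin m) (Fin m) ℝ) (w : Idx m → ℝ) :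
    (triangularRoot Om C *ᵥ w) (Sum.inl ()) = √(condVariance Om) * w (Sum.inl ()) +
      (Om.toBlocks₁₂ * (C⁻¹)ᵀ) () ⬝ᵥ fun i => w (Sum.inr i) := by
  rw [triangularRoot, Matrix.fromBlocks_mulVec]
  simp [Matrix.mulVec, dotProduct]

theorem triangularRoot_mulVec_inr {m : ℕ} (Om : Matrix (Idx m) (Idx m) ℝ)
    (C : Matrix (Fin m) (Fin m) ℝ) (w : Idx m → ℝ) (i : Fin m) :
    (triangularRoot Om C *ᵥ w) (Sum.inr i) = (C *ᵥ fun i => w (Sum.inr i)) i := by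
  rw [triangularRoot, Matrix.fromBlocks_mulVec]
  simp [Function.comp_def]

/-! ### Convergence of the statistic along convergent partial sum paths -/

/-- The drift `t μ` in the regressors is always a combination of the deterministic terms: it is zero
in `D0` and `D1`, and the trend of `D2` spans it. Detrending therefore removes it. -/
theorem exists_det_dotProduct_eq (c : DetCase) {m : ℕ} {μ : Fin m → ℝ}
    (hμ : c = .D0 ∨ c = .D1 → μ = 0) :
    ∃ B : Fin m → Fin c.dim → ℝ, ∀ t i, c.det t ⬝ᵥ B i = t * μ i := by
  cases c
  · exact ⟨fun _ => 0, fun t i => by simp [hμ (Or.inl rfl)]⟩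
  · exact ⟨fun _ => 0, fun t i => by simp [hμ (Or.inr rfl)]⟩
  · exact ⟨fun i => ![0, μ i], fun t i => by simp [DetCase.det, dotProduct]⟩

/-- The value at time `t / T` of a path on `[0,1]`. -/
noncomputable def atGrid {E : Type*} (f : I → E) (T t : ℕ) : E :=
  f (Set.projIcc 0 1 zero_le_one (t / T : ℝ))

/-- `z` is the variance ratio of data generated by the model under `ρ = 1`, with the partial sum
path `f` and initial values bounded by `M`. -/
def IsModelStatistic {m : ℕ} (c : DetCase) (μ β : Fin m → ℝ) (τ : Fin c.dim → ℝ) (M : ℝ)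
    (T : ℕ) (f : Skorokhod (Idx m → ℝ)) (z : ℝ) : Prop :=
  ∃ (x : ℕ → Fin m → ℝ) (y : ℕ → ℝ) (x₀ : Fin m → ℝ) (u₀ : ℝ), ‖x₀‖ ≤ M ∧ |u₀| ≤ M ∧
    z = varianceRatio T (residual c T x y) ∧
    ∀ t ∈ Finset.Icc 1 T,
      (∀ i, x t i = x₀ i + t * μ i + √(T : ℝ) * atGrid f.1 T t (Sum.inr i)) ∧
      y t = c.det t ⬝ᵥ τ + x t ⬝ᵥ β + (u₀ + √(T : ℝ) * atGrid f.1 T t (Sum.inl ()))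

theorem gridConv_atGrid {ι : Type*} [Fintype ι] {φ : ℕ → ℕ} {f : ℕ → Skorokhod (ι → ℝ)}
    {F : Skorokhod (ι → ℝ)} (hF : Continuous F.1) (hf : Tendsto f atTop (𝓝 F)) {p : ι → ℝ → ℝ}
    (hp : ∀ (r : I) i, F.1 r i = p i r) (i : ι) :
    GridConv φ (fun k t => atGrid (f k).1 (φ k) t i) (p i) := by
  intro ε hε
  filter_upwards [Metric.tendstoUniformly_iff.1 (Skorokhod.tendstoUniformly_of_tendsto hF hf) ε hε]
    with k hk t ht
  have h1 := (dist_le_pi_dist _ _ i).trans_lt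
    (hk (Set.projIcc 0 1 zero_le_one (t / φ k : ℝ)))
  rw [hp, Real.dist_eq, abs_sub_comm, Set.projIcc_of_mem _ (grid_mem_Icc ht)] at h1
  rwa [atGrid, Set.projIcc_of_mem _ (grid_mem_Icc ht)]

theorem tendsto_div_sqrt {φ : ℕ → ℕ} (hφ : Tendsto φ atTop atTop) {a : ℕ → ℝ} {M : ℝ}
    (ha : ∀ k, |a k| ≤ M) : Tendsto (fun k => a k / √(φ k : ℝ)) atTop (𝓝 0) := by
  have h : Tendsto (fun k => M / √(φ k : ℝ)) atTop (𝓝 0) :=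
    tendsto_const_nhds.div_atTop
      (Real.tendsto_sqrt_atTop.comp (tendsto_natCast_atTop_atTop.comp hφ))
  refine squeeze_zero_norm (fun k => ?_) h
  rw [Real.norm_eq_abs, abs_div, abs_of_nonneg (Real.sqrt_nonneg _)]
  gcongr
  exact ha k

/-- The deterministic core: finite sample invariance reduces the data to standardized series, whose
limits are the paths `w` without `Ω`, the slopes or the initial values. -/
theorem tendsto_isModelStatistic {m : ℕ} {c : DetCase} {μ β : Fin m → ℝ} {τ : Fin c.dim → ℝ}
    (hμ : c = .D0 ∨ c = .D1 → μ = 0) {Om : Matrix (Idx m) (Idx m) ℝ}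
    {C : Matrix (Fin m) (Fin m) ℝ} (hσ : 0 < condVariance Om) (hC : C.det ≠ 0)
    {w : Idx m → ℝ → ℝ} (hwc : ∀ i, Continuous (w i))
    (hw : ∀ (b : Idx m → ℝ) (c₀ c₁ : ℝ),
      (∀ r ∈ Set.Icc (0 : ℝ) 1, ∑ i, b i * w i r = c₀ + c₁ * r) → b = 0)
    {F : Skorokhod (Idx m → ℝ)} (hF : ∀ r : I, F.1 r = triangularRoot Om C *ᵥ fun i => w i r)
    {φ : ℕ → ℕ} (hφ : Tendsto φ atTop atTop) {f : ℕ → Skorokhod (Idx m → ℝ)}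
    (hf : Tendsto f atTop (𝓝 F)) {M : ℝ} {z : ℕ → ℝ}
    (hz : ∀ k, IsModelStatistic c μ β τ M (φ k) (f k) (z k)) :
    Tendsto z atTop
      (𝓝 ((∫ r in (0 : ℝ)..1, (∫ s in (0 : ℝ)..r, projectOut
          (fun r => fun i : Fin m => detrendPath c (w (Sum.inr i)) r)
          (detrendPath c (w (Sum.inl ()))) s) ^ 2) /
        ∫ r in (0 : ℝ)..1, projectOut (fun r => fun i : Fin m => detrendPath c (w (Sum.inr i)) r)
          (detrendPath c (w (Sum.inl ()))) r ^ 2)) := by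
  choose x y x₀ u₀ hx₀ hu₀ hzv hxy using hz
  set sd := √(condVariance Om) with hσdef
  have hσ0 : sd ≠ 0 := (Real.sqrt_pos.2 hσ).ne'
  set γ := (Om.toBlocks₁₂ * (C⁻¹)ᵀ) () with hγ
  have hC' := isUnit_iff_ne_zero.2 hC
  have hFc : Continuous F.1 := by
    have : F.1 = fun r : I => triangularRoot Om C *ᵥ fun i => w i r := funext hF
    rw [this]
    exact continuous_const.matrix_mulVec (by fun_prop)
  have hg := fun i => gridConv_atGrid (φ := φ) hFc hf
    (p := fun i r => (triangularRoot Om C *ᵥ fun i => w i r) i) (fun r i => by rw [hF]) i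
  -- The triangular root is inverted at the level of the data: `V` has limit `C W_v`, so `X` has
  -- limit `W_v`; subtracting `X'γ` and dividing by `sd` then leaves `W_{ξ·v}` as the limit of `Z`.
  let V : ℕ → ℕ → Fin m → ℝ := fun k t j =>
    x₀ k j / √(φ k : ℝ) + atGrid (f k).1 (φ k) t (Sum.inr j)
  let X : ℕ → ℕ → Fin m → ℝ := fun k t => C⁻¹ *ᵥ V k t
  let Z : ℕ → ℕ → ℝ := fun k t =>
    sd⁻¹ * (u₀ k / √(φ k : ℝ) + atGrid (f k).1 (φ k) t (Sum.inl ()) - X k t ⬝ᵥ γ)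
  have hV : ∀ j, GridConv φ (fun k t => V k t j) fun r => (C *ᵥ fun i => w (Sum.inr i) r) j := by
    intro j
    refine ((GridConv.const φ (tendsto_div_sqrt (M := M) hφ fun k => ?_)).add
      (hg (Sum.inr j))).congr_right fun r _ => ?_
    · exact (norm_le_pi_norm (x₀ k) j).trans (hx₀ k)
    · rw [triangularRoot_mulVec_inr, zero_add]
  have hX : ∀ i, GridConv φ (fun k t => X k t i) (w (Sum.inr i)) := by
    intro i
    refine (GridConv.sum Finset.univ fun j _ =>
      (GridConv.const φ (tendsto_const_nhds (x := C⁻¹ i j))).mul (hV j) continuous_const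
        ?_).congr_right fun r _ => ?_
    · simp only [Matrix.mulVec, dotProduct]
      fun_prop
    · change (C⁻¹ *ᵥ (C *ᵥ fun i => w (Sum.inr i) r)) i = _
      rw [Matrix.mulVec_mulVec, Matrix.nonsing_inv_mul _ hC', Matrix.one_mulVec]
  have hZ : GridConv φ Z (w (Sum.inl ())) := by
    have h1 := (GridConv.const φ (tendsto_div_sqrt hφ hu₀)).add (hg (Sum.inl ()))
    have h2 := GridConv.sum Finset.univ fun i _ => (hX i).mul
      (GridConv.const φ (tendsto_const_nhds (x := γ i))) (hwc _) continuous_const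
    refine ((GridConv.const φ (tendsto_const_nhds (x := sd⁻¹))).mul (h1.sub h2) continuous_const
      ?_).congr_right fun r _ => ?_
    · simp only [Matrix.mulVec, dotProduct]
      fun_prop
    · rw [triangularRoot_mulVec_inl]
      simp only [dotProduct, ← hγ, ← hσdef, mul_comm (γ _)]
      field_simp
      ring
  obtain ⟨B, hB⟩ := exists_det_dotProduct_eq c hμ
  obtain ⟨hdet, hlim⟩ := tendsto_varianceRatio_residual c hwc hw hφ hX hZ
  refine hlim.congr' ?_
  filter_upwards [hdet, eventually_gramSum_det c hφ, hφ.eventually_ne_atTop 0] with k h1 h2 h3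
  have hs : √(φ k : ℝ) ≠ 0 := by positivity
  have hCX : ∀ t, C *ᵥ X k t = V k t := fun t => by
    rw [Matrix.mulVec_mulVec, Matrix.mul_nonsing_inv _ hC', Matrix.one_mulVec]
  have hxt : ∀ t ∈ Finset.Icc 1 (φ k), x k t = √(φ k : ℝ) • (C *ᵥ X k t) +
      fun i => c.det t ⬝ᵥ B i := by
    intro t ht
    ext i
    rw [(hxy k t ht).1 i, hCX, Pi.add_apply, hB, Pi.smul_apply, smul_eq_mul]
    simp only [V]
    field_simp
    ring
  rw [hzv k]
  -- These constants come from solving for the data: `x = √T C X + B'd`, and the error is `√T (sd Z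
  -- + X'γ)`. Hence `y` has scale `√T sd` on `Z`, slope `√T (C'β + γ)` on `X`, and deterministic
  -- part `τ + ∑ β_i B_i`.
  refine (varianceRatio_const_mul (κ := √(φ k : ℝ) * sd) (by positivity)
    (residual_eq (A := √(φ k : ℝ) • C) (B := B) (β := √(φ k : ℝ) • (Cᵀ *ᵥ β + γ))
      (τ := τ + ∑ i, β i • B i) ?_ h2 h1 (fun t ht i => ?_) fun t ht => ?_)).symm
  · rw [Matrix.det_smul]
    positivity
  · rw [hxt t ht, Matrix.smul_mulVec]
    rfl
  · have e1 : (fun i => c.det t ⬝ᵥ B i) ⬝ᵥ β = c.det t ⬝ᵥ ∑ i, β i • B i := by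
      rw [dotProduct_sum]
      simp only [dotProduct_smul, smul_eq_mul]
      exact Finset.sum_congr rfl fun i _ => mul_comm _ _
    have e2 : X k t ⬝ᵥ (Cᵀ *ᵥ β) = (C *ᵥ X k t) ⬝ᵥ β := by
      rw [Matrix.dotProduct_mulVec, Matrix.vecMul_transpose]
    rw [(hxy k t ht).2, hxt t ht, add_dotProduct, smul_dotProduct, e1, dotProduct_add,
      dotProduct_smul, dotProduct_add, e2]
    simp only [Z, smul_eq_mul]
    field_simp
    ring

/-! ### The data generating process under the null hypothesis -/

theorem sum_Icc_int_succ {E : Type*} [AddCommMonoid E] (a : ℤ → E) (t : ℕ) :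
    ∑ s ∈ Finset.Icc (1 : ℤ) ((t + 1 : ℕ) : ℤ), a s =
      (∑ s ∈ Finset.Icc (1 : ℤ) t, a s) + a ((t : ℤ) + 1) := by
  have h : Finset.Icc (1 : ℤ) ((t + 1 : ℕ) : ℤ) =
      insert ((t : ℤ) + 1) (Finset.Icc (1 : ℤ) t) := by
    ext s
    simp only [Finset.mem_Icc, Finset.mem_insert]
    omega
  rw [h, Finset.sum_insert (by simp), add_comm]

theorem IsModel.x_eq_sum {S : Type*} [MeasurableSpace S] {P : Measure S} {m : ℕ} {c : DetCase}
    {ρ : ℝ} {μ β : Fin m → ℝ} {τ : Fin c.dim → ℝ} {ξ : ℤ → S → ℝ} {v : ℤ → S → Fin m → ℝ}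
    {x : ℕ → ℕ → S → Fin m → ℝ} {y u : ℕ → ℕ → S → ℝ}
    (h : IsModel P c ρ μ β τ ξ v x y u) (T t : ℕ) (ω : S) (i : Fin m) :
    x T t ω i = x T 0 ω i + t * μ i + ∑ s ∈ Finset.Icc (1 : ℤ) t, v s ω i := by
  induction t with
  | zero => simp
  | succ t ih =>
    rw [h.x_eq, sum_Icc_int_succ fun s => v s ω i, Pi.add_apply, Pi.add_apply, ih]
    push_cast
    ring

theorem IsModel.u_eq_sum {S : Type*} [MeasurableSpace S] {P : Measure S} {m : ℕ} {c : DetCase}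
    {μ β : Fin m → ℝ} {τ : Fin c.dim → ℝ} {ξ : ℤ → S → ℝ} {v : ℤ → S → Fin m → ℝ}
    {x : ℕ → ℕ → S → Fin m → ℝ} {y u : ℕ → ℕ → S → ℝ}
    (h : IsModel P c 1 μ β τ ξ v x y u) (T t : ℕ) (ω : S) :
    u T t ω = u T 0 ω + ∑ s ∈ Finset.Icc (1 : ℤ) t, ξ s ω := by
  induction t with
  | zero => simp
  | succ t ih =>
    rw [h.u_eq, sum_Icc_int_succ fun s => ξ s ω, ih]
    ring

/-- At `r = t / T` the floor is exactly `t`, so the step path loses nothing on the grid. -/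
theorem sqrt_mul_atGrid_partialSumPath {ι : Type*} [Fintype ι] (a : ℤ → ι → ℝ) {T t : ℕ}
    (ht : t ∈ Finset.Icc 1 T) (i : ι) :
    √(T : ℝ) * atGrid (partialSumPath a T) T t i = ∑ s ∈ Finset.Icc (1 : ℤ) t, a s i := by
  have hT : T ≠ 0 := by
    rw [Finset.mem_Icc] at ht
    omega
  have hs : √(T : ℝ) ≠ 0 := by positivity
  have hfl : ⌊(t / T : ℝ) * T⌋ = t := by
    rw [div_mul_cancel₀ _ (by positivity), Int.floor_natCast]
  rw [atGrid, Set.projIcc_of_mem _ (grid_mem_Icc ht), partialSumPath]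
  simp only [hfl, Pi.smul_apply, Finset.sum_apply, smul_eq_mul]
  rw [mul_inv_cancel_left₀ hs]

theorem isModelStatistic_of_isModel {S : Type*} [MeasurableSpace S] {P : Measure S} {m : ℕ}
    {c : DetCase} {μ β : Fin m → ℝ} {τ : Fin c.dim → ℝ} {ξ : ℤ → S → ℝ} {v : ℤ → S → Fin m → ℝ}
    {x : ℕ → ℕ → S → Fin m → ℝ} {y u : ℕ → ℕ → S → ℝ}
    (h : IsModel P c 1 μ β τ ξ v x y u) {M : ℝ} {T : ℕ} {ω : S} (hx₀ : ‖x T 0 ω‖ ≤ M)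
    (hu₀ : ‖u T 0 ω‖ ≤ M) :
    IsModelStatistic c μ β τ M T (partialSumProcess (stack ξ v) T ω)
      (varianceRatio T (residual c T (fun t => x T t ω) fun t => y T t ω)) := by
  refine ⟨_, _, x T 0 ω, u T 0 ω, hx₀, hu₀, rfl, fun t ht => ⟨fun i => ?_, ?_⟩⟩
  · rw [partialSumProcess, sqrt_mul_atGrid_partialSumPath _ ht, h.x_eq_sum T t ω i]
    rfl
  · obtain ⟨t, rfl⟩ := Nat.exists_eq_succ_of_ne_zero (Nat.one_le_iff_ne_zero.1
      (Finset.mem_Icc.1 ht).1)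
    rw [partialSumProcess, sqrt_mul_atGrid_partialSumPath _ ht]
    refine (h.y_eq T t ω).trans ?_
    rw [h.u_eq_sum]
    rfl

theorem measurable_statistic {S : Type*} [MeasurableSpace S] {P : Measure S} {m : ℕ}
    {c : DetCase} {ρ : ℝ} {μ β : Fin m → ℝ} {τ : Fin c.dim → ℝ} {ξ : ℤ → S → ℝ}
    {v : ℤ → S → Fin m → ℝ} {x : ℕ → ℕ → S → Fin m → ℝ} {y u : ℕ → ℕ → S → ℝ}
    (hm : ∀ t, Measurable (stack ξ v t)) (h : IsModel P c ρ μ β τ ξ v x y u) (T : ℕ) :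
    Measurable fun ω => varianceRatio T (residual c T (fun t => x T t ω) fun t => y T t ω) := by
  have hξ : ∀ t, Measurable (ξ t) := fun t => measurable_pi_iff.1 (hm t) (Sum.inl ())
  have hv : ∀ t i, Measurable fun ω => v t ω i := fun t i =>
    measurable_pi_iff.1 (hm t) (Sum.inr i)
  have hx : ∀ t i, Measurable fun ω => x T t ω i := fun t i => by
    simp only [h.x_eq_sum T t]
    exact ((measurable_pi_iff.1 (h.measurable_x₀ T) i).add_const _).add
      (Finset.measurable_sum _ fun s _ => hv s i)
  have hu : ∀ t, Measurable (u T t) := fun t => by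
    induction t with
    | zero => exact h.measurable_u₀ T
    | succ t ih =>
      have : u T (t + 1) = fun ω => ρ * u T t ω + ξ ((t : ℤ) + 1) ω := funext (h.u_eq T t)
      rw [this]
      exact (ih.const_mul ρ).add (hξ _)
  refine measurable_varianceRatio_residual c (fun t _ => hx t) fun t ht => ?_
  obtain ⟨t, rfl⟩ := Nat.exists_eq_succ_of_ne_zero (Nat.one_le_iff_ne_zero.1
    (Finset.mem_Icc.1 ht).1)
  have : y T (t + 1) = fun ω => c.det (t + 1) ⬝ᵥ τ + x T (t + 1) ω ⬝ᵥ β + u T (t + 1) ω :=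
    funext (h.y_eq T t)
  rw [Nat.succ_eq_add_one, this]
  exact (measurable_const.add (Finset.measurable_sum _ fun i _ =>
    (hx _ i).mul_const _)).add (hu _)

/-! ### The limiting random variable -/

theorem IsStdBrownian.ae_continuous {S ι : Type*} [MeasurableSpace S] [Countable ι] {P : Measure S}
    {W : ι → ℝ≥0 → S → ℝ} (hW : IsStdBrownian P W) :
    ∀ᵐ ω ∂P, ∀ i, Continuous fun r : ℝ => W i r.toNNReal ω := by
  filter_upwards [ae_all_iff.2 fun i => (hW.brownian i).cont] with ω hω i
  exact (hω i).comp continuous_real_toNNReal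

/-- The limit variable is almost surely the limit of the variance ratios computed from the Brownian
paths sampled at `t / T`, so the convergence theorem itself supplies measurability. -/
theorem aemeasurable_limitVR (c : DetCase) {m : ℕ} {S : Type*} [MeasurableSpace S] {P : Measure S}
    [IsProbabilityMeasure P] {W : Idx m → ℝ≥0 → S → ℝ} (hW : IsStdBrownian P W) :
    AEMeasurable (limitVR c W) P := by
  have hm := fun i t => (hW.brownian i).aemeasurable t
  -- Each `W i t` is only almost everywhere measurable; measurable versions agree with it
  -- simultaneously at the countably many times `t / T`.
  let W' : Idx m → ℝ≥0 → S → ℝ := fun i t => (hm i t).mk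
  have hW' : ∀ᵐ ω ∂P, ∀ (i : Idx m) (T t : ℕ),
      W i (t / T : ℝ).toNNReal ω = W' i (t / T : ℝ).toNNReal ω :=
    ae_all_iff.2 fun i => ae_all_iff.2 fun T => ae_all_iff.2 fun t => (hm i _).ae_eq_mk
  refine aemeasurable_of_tendsto_metrizable_ae' (f := fun T ω => varianceRatio T (residual c T
    (fun t i => W' (Sum.inr i) (t / T : ℝ).toNNReal ω)
    fun t => W' (Sum.inl ()) (t / T : ℝ).toNNReal ω)) (fun T => ?_) ?_
  · exact (measurable_varianceRatio_residual c
      (x := fun t ω i => W' (Sum.inr i) (t / T : ℝ).toNNReal ω)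
      (fun t _ i => (hm _ _).measurable_mk) fun t _ => (hm _ _).measurable_mk).aemeasurable
  · filter_upwards [hW', hW.ae_continuous, hW.ae_not_affine] with ω h1 h2 h3
    have h4 := (tendsto_varianceRatio_residual c (w := fun i r => W i r.toNNReal ω) h2 h3
      (φ := id) tendsto_id (fun i => GridConv.self id _) (GridConv.self id _)).2
    simp only [id_eq, h1] at h4
    exact h4

/-- If a path of `W` is continuous, so is the path of `A W`, which is then càdlàg. -/
theorem ofPath_linearPath {ι S : Type*} [Fintype ι] (A : Matrix ι ι ℝ) {W : ι → ℝ≥0 → S → ℝ}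
    {ω : S} (h : ∀ i, Continuous fun r : ℝ => W i r.toNNReal ω) (r : I) :
    (Skorokhod.ofPath (linearPath A W ω)).1 r = A *ᵥ fun i => W i (r : ℝ).toNNReal ω := by
  have hc : Continuous (linearPath A W ω) :=
    continuous_const.matrix_mulVec (continuous_pi fun i => (h i).comp continuous_subtype_val)
  have hcad : IsCadlag (linearPath A W ω) := fun r =>
    ⟨hc.continuousWithinAt, _, (hc.tendsto r).mono_left nhdsWithin_le_nhds⟩
  have h1 : Skorokhod.ofPath (linearPath A W ω) = ⟨linearPath A W ω, hcad⟩ := dif_pos hcad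
  rw [h1]
  rfl

theorem IsBoundedInProb.exists_forall_ge {S E : Type*} [MeasurableSpace S] [NormedAddCommGroup E]
    {P : Measure S} [IsProbabilityMeasure P] {X : ℕ → S → E} (h : IsBoundedInProb P X) {η : ℝ≥0}
    (hη : 0 < η) : ∃ M₀ : ℝ, ∀ M ≥ M₀, ∀ᶠ T in atTop, P {ω | M < ‖X T ω‖} ≤ η := by
  obtain ⟨M₀, h0⟩ := h η (by exact_mod_cast hη)
  refine ⟨M₀, fun M hM => h0.mono fun T hT => ?_⟩
  refine (measure_mono fun ω (hω : M < _) => hM.trans_lt hω).trans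
    (?_ : P {ω | M₀ < ‖X T ω‖} ≤ η)
  rw [← ofReal_measureReal, ← ENNReal.ofReal_coe_nnreal]
  exact ENNReal.ofReal_le_ofReal hT

end VarianceRatio

open VarianceRatio
theorem proposition1 {S S' : Type*} [MeasurableSpace S] [MeasurableSpace S']
    (P : Measure S) [IsProbabilityMeasure P] (P' : Measure S') [IsProbabilityMeasure P']
    {m : ℕ} (c : DetCase) (μ β : Fin m → ℝ) (τ : Fin c.dim → ℝ)
    (ξ : ℤ → S → ℝ) (v : ℤ → S → Fin m → ℝ)
    (x : ℕ → ℕ → S → Fin m → ℝ) (y u : ℕ → ℕ → S → ℝ)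
    (f : ℝ → Matrix (Idx m) (Idx m) ℂ) (C : Matrix (Fin m) (Fin m) ℝ)
    (W : Idx m → ℝ≥0 → S' → ℝ)
    (hw : ErrorAssumption P P' ξ v f C W)
    (hmodel : IsModel P c 1 μ β τ ξ v x y u) :
    TendstoInDistribution
      (fun (T : ℕ) (ω : S) =>
        varianceRatio T (residual c T (fun t => x T t ω) (fun t => y T t ω)))
      atTop (limitVR c W) (fun _ => P) P' := by
  refine tendstoInDistribution_of_relation hw.fclt
    (fun T => (measurable_statistic hw.measurable hmodel T).aemeasurable)
    (aemeasurable_limitVR c hw.brownian) fun η hη => ?_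
  -- Each initial value may exceed its bound with probability `η / 2`; off these two events the
  -- relation holds.
  obtain ⟨M₁, h1⟩ := hmodel.x₀_bounded.exists_forall_ge (half_pos hη)
  obtain ⟨M₂, h2⟩ := hmodel.u₀_bounded.exists_forall_ge (half_pos hη)
  refine ⟨IsModelStatistic c μ β τ (max M₁ M₂), ?_, ?_⟩
  · filter_upwards [h1 _ (le_max_left M₁ M₂), h2 _ (le_max_right M₁ M₂)] with T hT1 hT2
    calc _ ≤ P ({ω | max M₁ M₂ < ‖x T 0 ω‖} ∪ {ω | max M₁ M₂ < ‖u T 0 ω‖}) := by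
          refine measure_mono fun ω hω => ?_
          by_contra hne
          simp only [Set.mem_union, Set.mem_ofPred_eq, not_or, not_lt] at hne
          exact hω (isModelStatistic_of_isModel hmodel hne.1 hne.2)
      _ ≤ ((η / 2 : ℝ≥0) : ENNReal) + ((η / 2 : ℝ≥0) : ENNReal) :=
          (measure_union_le _ _).trans (add_le_add hT1 hT2)
      _ = η := by rw [← ENNReal.coe_add, add_halves]
  · filter_upwards [hw.brownian.ae_continuous, hw.brownian.ae_not_affine] with ω hc hna φ g z hφ hg hz
    exact tendsto_isModelStatistic hmodel.drift_zero (condVariance_pos hw.longRun_posDef)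
      (det_ne_zero_of_root hw.longRun_posDef hw.root) (w := fun i r => W i r.toNNReal ω) hc hna
      (ofPath_linearPath _ hc) hφ hg hz
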